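/- Let $\alpha\in(-1,1)\setminus\{0\}$ and set $c_3=\frac{\alpha(1-\alpha^2)}{6}$ and $c_4=\frac{\alpha^2(1-\alpha^2)}{8}>0$. For an integer $p\ge 1$, $x\in\mathbb{R}$ and $y>0$ let $$G_p(x,y)=\frac{1}{2\pi}\int_{\mathbb{R}}(i\theta)^p\,e^{ix\theta}\,e^{ic_3y\theta^3}\,e^{-c_4y\theta^4}\,d\theta ,$$ and, for any $\eta>0$ (the value does not depend on the choice of $\eta$), let $$A(x,y)=\frac{1}{2\pi}\int_{\mathbb{R}}e^{x(\eta+i\theta)}\,e^{-c_3y(\eta+i\theta)^3}\,e^{-c_4y(\eta+i\theta)^4}\,\frac{d\theta}{\eta+i\theta}.$$ (1) Suppose $c_3>0$, that is, $\alpha\in(0,1)$. For every integer $p\ge1$, every $y_{\min}>0$ and every $\underline{c}>0$, there exist constants $C>0$ and $c>0$ such that for all $x\in\mathbb{R}$ and all $y\ge y_{\min}$: $$|G_p(x,y)|\le\begin{cases} \dfrac{C}{y^{(p+1)/4}}\exp\!\big(-c\,x^{4/3}/y^{1/3}\big), & x\ge\underline{c}\,y,\\[2mm] \dfrac{C}{y^{1/3+p/4}}\exp\!\big(-c\,x^{3/2}/y^{1/2}\big),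 & 0\le x\le\underline{c}\,y,\\[2mm] \dfrac{C}{y^{1/3+p/4}}, & -y^{1/3}\le x\le0,\\[2mm] \dfrac{C}{|x|^{1/4}\,y^{(p+1)/4}}\exp\!\big(-c\,x^2/y\big), & -\underline{c}\,y\le x\le-y^{1/3},\\[2mm] \dfrac{C}{y^{(p+1)/4}}\exp\!\big(-c\,|x|^{4/3}/y^{1/3}\big), & x\le-\underline{c}\,y. \end{cases}$$ (2) If $c_3<0$, that is, $\alpha\in(-1,0)$, the same statement holds with $x$ replaced by $-x$ on the right-hand side (in the bounds and in the conditions defining the regimes). (3) Suppose $\alpha\in(-1,0)$. There exist constants $C>0$ and $c>0$ such that for all integers $n\ge1$ and $j_0\ge1$ with $n|\alpha|/2\le j_0\le n$: $$\Big|A\big(-j_0+n|\alpha|,\,j_0/|\alpha|\big)-A\big(-j_0+n|\alpha|,\,n\big)\Big|\le C\begin{cases} \dfrac{1}{n^{1/3}}\exp\!\big(-c\,|j_0-n|\alpha||^{3/2}/n^{1/2}\big), & j_0\ge n|\alpha|,\\[2mm] \dfrac{1}{n^{1/3}}, & 0\le n|\alpha|-j_0\le n^{1/3},\\[2mm] \dfrac{1}{|j_0-n|\alpha||^{1/4}\,n^{1/4}}\exp\!\big(-c\,|j_0-n|\alpha||^2/n\big),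 & n|\alpha|-j_0\ge n^{1/3}. \end{cases}$$ In (1), (2) and (3), where the conditions of two cases overlap, both bounds hold. -/

import Mathlib

namespace LaxWendroff

/-- The dispersion coefficient `c₃ = α (1 - α²) / 6`. -/
noncomputable def c₃ (α : ℝ) : ℝ := α * (1 - α ^ 2) / 6

/-- The dissipation coefficient `c₄ = α² (1 - α²) / 8`. -/
noncomputable def c₄ (α : ℝ) : ℝ := α ^ 2 * (1 - α ^ 2) / 8

/-- The corrector
`G_p(x,y) = (1/2π) ∫ (iθ)^p e^{ixθ} e^{i c₃ y θ³} e^{-c₄ y θ⁴} dθ`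
(absolutely convergent for `0 < |α| < 1` and `y > 0`). -/
noncomputable def corrector (α : ℝ) (p : ℕ) (x y : ℝ) : ℂ :=
  (1 / (2 * (Real.pi : ℂ))) *
    ∫ θ : ℝ, (Complex.I * (θ : ℂ)) ^ p
      * Complex.exp (Complex.I * (x : ℂ) * (θ : ℂ))
      * Complex.exp (Complex.I * (c₃ α : ℂ) * (y : ℂ) * (θ : ℂ) ^ 3)
      * Complex.exp (-(c₄ α : ℂ) * (y : ℂ) * (θ : ℂ) ^ 4)

/-- The activation function, written on the line of abscissa `η`:
`A(x,y) = (1/2π) ∫ e^{x τ} e^{-c₃ y τ³} e^{-c₄ y τ⁴} dθ / τ` with `τ = η + iθ`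
(absolutely convergent for `0 < |α| < 1`, `η > 0` and `y > 0`; its value is then
the same for all `η > 0`). -/
noncomputable def activation (α η x y : ℝ) : ℂ :=
  (1 / (2 * (Real.pi : ℂ))) *
    ∫ θ : ℝ, Complex.exp ((x : ℂ) * ((η : ℂ) + Complex.I * (θ : ℂ)))
      * Complex.exp (-(c₃ α : ℂ) * (y : ℂ) * ((η : ℂ) + Complex.I * (θ : ℂ)) ^ 3)
      * Complex.exp (-(c₄ α : ℂ) * (y : ℂ) * ((η : ℂ) + Complex.I * (θ : ℂ)) ^ 4)
      / ((η : ℂ) + Complex.I * (θ : ℂ))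

/-- The number `B` obeys, at the point `(x, y)`, the five-regime bound of order `p` with
constants `C`, `c`, the regimes being separated by `± k y`, `-y^{1/3}` and `0`. -/
def RegimeBound (p : ℕ) (k C c x y B : ℝ) : Prop :=
  (k * y ≤ x →
    B ≤ C / y ^ (((p : ℝ) + 1) / 4)
      * Real.exp (-c * (x ^ (4 / 3 : ℝ) / y ^ (1 / 3 : ℝ)))) ∧
  (0 ≤ x → x ≤ k * y →
    B ≤ C / y ^ ((1 : ℝ) / 3 + (p : ℝ) / 4)
      * Real.exp (-c * (x ^ (3 / 2 : ℝ) / y ^ (1 / 2 : ℝ)))) ∧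
  (-y ^ (1 / 3 : ℝ) ≤ x → x ≤ 0 →
    B ≤ C / y ^ ((1 : ℝ) / 3 + (p : ℝ) / 4)) ∧
  (-(k * y) ≤ x → x ≤ -y ^ (1 / 3 : ℝ) →
    B ≤ C / (|x| ^ (1 / 4 : ℝ) * y ^ (((p : ℝ) + 1) / 4))
      * Real.exp (-c * (x ^ 2 / y))) ∧
  (x ≤ -(k * y) →
    B ≤ C / y ^ (((p : ℝ) + 1) / 4)
      * Real.exp (-c * (|x| ^ (4 / 3 : ℝ) / y ^ (1 / 3 : ℝ))))

end LaxWendroff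

namespace LaxWendroff

open MeasureTheory Filter Topology Set
open Complex (I)

/-! Up to the factor `1/(2π)`, the corrector is the integral of the entire function `τ^p exp(xτ - a
y τ³ - b y τ⁴)` along the imaginary axis, with `a = c₃` and `b = c₄`. The quartic term makes it
decay in every vertical strip, so the line may be moved to any abscissa `η` (`lineIntegral_eq`).
Each regime comes from a good choice of `η`. Take `a > 0`.

For `|x| ≥ k y`, take `η` of size `(|x|/y)^{1/3}` and of sign opposite to `x`. The gain `xη` is then
of order `|x|^{4/3}/y^{1/3}` and beats the growth of the other terms. For `x` nonnegative or of
order `y^{1/3}`, the line goes to the left, `η = -h`: there the cubic term yields a Gaussian of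
width `(y h)^{-1/2}`. With `h` of order `y^{-1/3}` this is the transition zone; with `h` of order
`(x/y)^{1/2}` the gain is `x^{3/2}/y^{1/2}`.

For `-k y ≤ x < 0` the cubic phase has real stationary points and absolute values are not enough. On
the line `η = δ|x|/y` the gain is of order `x²/y`, while the incomplete Airy integrals are at most a
multiple of `(|x| y)^{-1/4}`, by van der Corput (`norm_integral_cubic_phase_le`). Integration by
parts against the remaining amplitude combines the two (`norm_lineIntegral_le_oscillatory`). Powers
of `τ` cost `y^{-p/4}` throughout, the scale of the quartic exponential. The case `a < 0` follows
from `θ ↦ -θ`.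

For the activation function, the derivative in `y` brings down `-aτ³ - bτ⁴`, which cancels the pole
and leaves the line integrals of orders 2 and 3. The mean value inequality between `n` and `j₀/|α|`
costs a factor `|j₀ - n|α||/|α|`, absorbed by the extra decay in `n` and part of the exponential. -/

/-! ### Contour shifts and elementary exponential estimates -/

/-- The integral of an entire function along a vertical line does not depend on the abscissa,
provided that the function is dominated on the strip by an integrable function of the ordinate
that vanishes at infinity. -/
theorem integral_vertical_line_eq {f : ℂ → ℂ} (hf : Differentiable ℂ f) {η₁ η₂ : ℝ} {B : ℝ → ℝ}
    (hB : Integrable B) (hBtop : Tendsto B atTop (𝓝 0)) (hBbot : Tendsto B atBot (𝓝 0))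
    (hfB : ∀ η ∈ uIcc η₁ η₂, ∀ θ : ℝ, ‖f (η + θ * I)‖ ≤ B θ) :
    ∫ θ : ℝ, f (η₁ + θ * I) = ∫ θ : ℝ, f (η₂ + θ * I) := by
  have hint : ∀ η ∈ uIcc η₁ η₂, Integrable fun θ : ℝ => f (η + θ * I) := fun η hη =>
    hB.mono' (by have := hf.continuous; exact Continuous.aestronglyMeasurable (by fun_prop))
      (Eventually.of_forall (hfB η hη))
  have hlim : ∀ η ∈ uIcc η₁ η₂, Tendsto (fun T : ℝ => ∫ θ in -T..T, f (η + θ * I)) atTop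
      (𝓝 (∫ θ : ℝ, f (η + θ * I))) := fun η hη =>
    intervalIntegral_tendsto_integral (hint η hη) tendsto_neg_atTop_atBot tendsto_id
  -- The horizontal sides of the rectangle have fixed length and vanish with `B`; `u` is `T` or
  -- `-T`.
  have hor : ∀ u : ℝ → ℝ, Tendsto (fun T => B (u T)) atTop (𝓝 0) →
      Tendsto (fun T : ℝ => ∫ x in η₁..η₂, f (x + (u T : ℝ) * I)) atTop (𝓝 0) := by
    intro u hu
    refine squeeze_zero_norm (a := fun T => B (u T) * |η₂ - η₁|) (fun T => ?_) ?_
    · exact intervalIntegral.norm_integral_le_of_norm_le_const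
        fun x hx => hfB x (uIoc_subset_uIcc hx) _
    · simpa using hu.mul_const |η₂ - η₁|
  have hbot := hor (fun T => -T) (hBbot.comp tendsto_neg_atTop_atBot)
  have htop := hor (fun T => T) hBtop
  have hrect : ∀ T : ℝ, (∫ x in η₁..η₂, f (x + ((-T : ℝ) : ℂ) * I))
      - (∫ x in η₁..η₂, f (x + (T : ℂ) * I)) + I * (∫ θ in -T..T, f (η₂ + θ * I))
      - I * (∫ θ in -T..T, f (η₁ + θ * I)) = 0 := by
    intro T
    have := Complex.integral_boundary_rect_eq_zero_of_differentiableOn f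
      (η₁ + ((-T : ℝ) : ℂ) * I) (η₂ + (T : ℂ) * I) hf.differentiableOn
    simpa using this
  have hsum := ((hbot.sub htop).add ((hlim η₂ right_mem_uIcc).const_mul I)).sub
    ((hlim η₁ left_mem_uIcc).const_mul I)
  have h0 := tendsto_nhds_unique (hsum.congr hrect) tendsto_const_nhds
  have h1 : I * ((∫ θ : ℝ, f (η₂ + θ * I)) - ∫ θ : ℝ, f (η₁ + θ * I)) = 0 := by
    linear_combination h0
  exact (sub_eq_zero.1 ((mul_eq_zero.1 h1).resolve_left Complex.I_ne_zero)).symm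

/-- A power of `1 + z` is dominated by `exp (c w)` as soon as `z ≤ w + 1`. -/
theorem exists_one_add_pow_le_exp (n : ℕ) {c : ℝ} (hc : 0 < c) :
    ∃ C : ℝ, 0 < C ∧ ∀ z w : ℝ, 0 ≤ z → z ≤ w + 1 → (1 + z) ^ n ≤ C * Real.exp (c * w) := by
  -- The constant comes from `t ^ n / n! ≤ exp t` at `t = c (2 + w)`.
  refine ⟨n.factorial / c ^ n * Real.exp (2 * c), by positivity, fun z w hz hw => ?_⟩
  have h1 := Real.pow_div_factorial_le_exp (x := c * (2 + w))
    (mul_nonneg hc.le (by linarith)) n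
  rw [div_le_iff₀ (by positivity), mul_pow] at h1
  calc (1 + z) ^ n ≤ (2 + w) ^ n := by gcongr ?_ ^ n; linarith
    _ = (c ^ n * (2 + w) ^ n) / c ^ n := by field_simp
    _ ≤ Real.exp (c * (2 + w)) * n.factorial / c ^ n := by gcongr
    _ = _ := by rw [show c * (2 + w) = 2 * c + c * w by ring, Real.exp_add]; ring

theorem integrable_exp_neg_mul_pow_four {q : ℝ} (hq : 0 < q) :
    Integrable fun θ : ℝ => Real.exp (-q * θ ^ 4) := by
  -- Comparison with a Gaussian: `(θ² - 1)² ≥ 0` gives `-θ⁴ ≤ 1 - θ²`.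
  refine ((integrable_exp_neg_mul_sq hq).const_mul (Real.exp q)).mono' (by fun_prop)
    (Eventually.of_forall fun θ => ?_)
  rw [Real.norm_eq_abs, Real.abs_exp, ← Real.exp_add, Real.exp_le_exp]
  nlinarith [mul_nonneg hq.le (sq_nonneg (θ ^ 2 - 1)), mul_nonneg hq.le (sq_nonneg θ)]

theorem integral_exp_neg_mul_pow_four_pos {q : ℝ} (hq : 0 < q) :
    0 < ∫ θ : ℝ, Real.exp (-q * θ ^ 4) := by
  exact integral_exp_pos (integrable_exp_neg_mul_pow_four hq)

theorem integral_exp_neg_mul_scaled_pow_four (q : ℝ) {u : ℝ} (hu : 0 < u) :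
    ∫ θ : ℝ, Real.exp (-q * (u * θ) ^ 4) = u⁻¹ * ∫ θ : ℝ, Real.exp (-q * θ ^ 4) := by
  rw [Measure.integral_comp_mul_left (fun θ : ℝ => Real.exp (-q * θ ^ 4)),
    abs_of_pos (by positivity), smul_eq_mul]

theorem integrable_exp_neg_mul_scaled_pow_four {q u : ℝ} (hq : 0 < q) (hu : 0 < u) :
    Integrable fun θ : ℝ => Real.exp (-q * (u * θ) ^ 4) :=
  (integrable_exp_neg_mul_pow_four hq).comp_mul_left' hu.ne'

theorem norm_add_mul_I_le (η θ : ℝ) : ‖(η : ℂ) + θ * I‖ ≤ |η| + |θ| := by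
  simpa using norm_add_le (η : ℂ) (θ * I)

/-- Powers of `τ = η + iθ` are absorbed by half of a quartic exponential. -/
theorem exists_norm_pow_mul_exp_le (p : ℕ) {q : ℝ} (hq : 0 < q) :
    ∃ C : ℝ, 0 < C ∧ ∀ u η θ : ℝ, 0 < u →
      ‖(η : ℂ) + θ * I‖ ^ p * Real.exp (-(2 * q) * (u * θ) ^ 4) ≤
        C * ((1 + u * |η|) / u) ^ p * Real.exp (-q * (u * θ) ^ 4) := by
  obtain ⟨C, hC, h⟩ := exists_one_add_pow_le_exp p hq
  refine ⟨C, hC, fun u η θ hu => ?_⟩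
  have hw : u * |θ| ≤ (u * θ) ^ 4 + 1 := by
    have h1 : (u * θ) ^ 4 = (u * |θ|) ^ 4 := by
      rw [mul_pow, mul_pow, ← abs_pow, abs_of_nonneg (by positivity : (0:ℝ) ≤ θ ^ 4)]
    rw [h1]
    nlinarith [sq_nonneg ((u * |θ|) ^ 2 - 1), sq_nonneg (u * |θ| - 1)]
  have h2 := h (u * |θ|) _ (by positivity) hw
  have h3 : ‖(η : ℂ) + θ * I‖ ≤ (1 + u * |η|) / u * (1 + u * |θ|) := by
    refine (norm_add_mul_I_le η θ).trans ?_
    rw [div_mul_eq_mul_div, le_div_iff₀ hu]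
    nlinarith [mul_nonneg (mul_nonneg hu.le (abs_nonneg η)) (mul_nonneg hu.le (abs_nonneg θ))]
  calc _ ≤ ((1 + u * |η|) / u * (1 + u * |θ|)) ^ p * Real.exp (-(2 * q) * (u * θ) ^ 4) := by
        gcongr
    _ = ((1 + u * |η|) / u) ^ p * (1 + u * |θ|) ^ p * Real.exp (-(2 * q) * (u * θ) ^ 4) := by
        rw [mul_pow]
    _ ≤ ((1 + u * |η|) / u) ^ p * (C * Real.exp (q * (u * θ) ^ 4))
          * Real.exp (-(2 * q) * (u * θ) ^ 4) := by gcongr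
    _ = C * ((1 + u * |η|) / u) ^ p *
          (Real.exp (q * (u * θ) ^ 4) * Real.exp (-(2 * q) * (u * θ) ^ 4)) := by ring
    _ = _ := by rw [← Real.exp_add]; ring_nf

/-! ### Oscillatory integrals with cubic phase -/

/-- First derivative test of van der Corput. -/
theorem norm_integral_cexp_phase_le {φ φ' φ'' : ℝ → ℝ} {s t m : ℝ} (hst : s ≤ t) (hm : 0 < m)
    (hφ : ∀ θ, HasDerivAt φ (φ' θ) θ) (hφ' : ∀ θ, HasDerivAt φ' (φ'' θ) θ)
    (hcont : Continuous φ'') (hlow : ∀ θ ∈ Icc s t, m ≤ |φ' θ|)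
    (hconv : ∀ θ ∈ Icc s t, 0 ≤ φ'' θ) :
    ‖∫ θ in s..t, Complex.exp (I * φ θ)‖ ≤ 4 / m := by
  have hφ'c : Continuous φ' := continuous_iff_continuousAt.2 fun θ => (hφ' θ).continuousAt
  have hφc : Continuous φ := continuous_iff_continuousAt.2 fun θ => (hφ θ).continuousAt
  have hne : ∀ θ ∈ uIcc s t, φ' θ ≠ 0 := fun θ hθ h0 => by
    have := hlow θ (by rwa [uIcc_of_le hst] at hθ)
    rw [h0, abs_zero] at this
    linarith
  have hinv : ∀ θ ∈ uIcc s t, HasDerivAt (fun θ => (φ' θ)⁻¹) (-φ'' θ / φ' θ ^ 2) θ :=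
    fun θ hθ => (hφ' θ).inv (hne θ hθ)
  have hcontdiv : ContinuousOn (fun θ => -φ'' θ / φ' θ ^ 2) (uIcc s t) :=
    hcont.neg.continuousOn.div (hφ'c.pow 2).continuousOn fun θ hθ => pow_ne_zero 2 (hne θ hθ)
  have hv : ∀ θ ∈ uIcc s t, HasDerivAt (fun θ : ℝ => -I * Complex.exp (I * φ θ))
      (φ' θ * Complex.exp (I * φ θ)) θ := by
    intro θ _
    have h1 : HasDerivAt (fun θ : ℝ => Complex.exp (I * φ θ))
        (Complex.exp (I * φ θ) * (I * (φ' θ : ℂ))) θ :=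
      ((hφ θ).ofReal_comp.const_mul I).cexp
    refine (h1.const_mul (-I)).congr_deriv ?_
    linear_combination (-(Complex.exp (I * φ θ) * φ' θ)) * Complex.I_mul_I
  have hparts := intervalIntegral.integral_mul_deriv_eq_deriv_mul
    (u := fun θ : ℝ => (((φ' θ)⁻¹ : ℝ) : ℂ)) (u' := fun θ : ℝ => ((-φ'' θ / φ' θ ^ 2 : ℝ) : ℂ))
    (fun θ hθ => (hinv θ hθ).ofReal_comp) hv
    (ContinuousOn.intervalIntegrable (by
      exact Complex.continuous_ofReal.comp_continuousOn hcontdiv))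
    (Continuous.intervalIntegrable (by fun_prop) _ _)
  have hleft : ∫ θ in s..t, Complex.exp (I * φ θ)
      = ∫ θ in s..t, (((φ' θ)⁻¹ : ℝ) : ℂ) * (φ' θ * Complex.exp (I * φ θ)) := by
    refine intervalIntegral.integral_congr fun θ hθ => ?_
    have h0 : (φ' θ : ℂ) ≠ 0 := by exact_mod_cast hne θ hθ
    simp only [Complex.ofReal_inv]
    field_simp
  have hnorm : ∀ θ : ℝ, ‖-I * Complex.exp (I * φ θ)‖ = 1 := fun θ => by
    rw [norm_mul, norm_neg, Complex.norm_I, one_mul, mul_comm, Complex.norm_exp_ofReal_mul_I]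
  have hinvle : ∀ θ ∈ Icc s t, |(φ' θ)⁻¹| ≤ 1 / m := fun θ hθ => by
    rw [abs_inv, ← one_div]
    exact one_div_le_one_div_of_le hm (hlow θ hθ)
  have hs := hinvle s (left_mem_Icc.2 hst)
  have ht := hinvle t (right_mem_Icc.2 hst)
  have htv : ‖∫ θ in s..t, ((-φ'' θ / φ' θ ^ 2 : ℝ) : ℂ) * (-I * Complex.exp (I * φ θ))‖
      ≤ 2 / m := by
    -- Since `φ'' ≥ 0`, the derivative of `1/φ'` has constant sign, so its total variation is a
    -- difference of endpoint values.
    calc _ ≤ ∫ θ in s..t, -(-φ'' θ / φ' θ ^ 2) := by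
          refine intervalIntegral.norm_integral_le_of_norm_le hst
            (Eventually.of_forall fun θ hθ => ?_) hcontdiv.neg.intervalIntegrable
          rw [norm_mul, hnorm, mul_one, Complex.norm_real, Real.norm_eq_abs, abs_of_nonpos]
          exact div_nonpos_of_nonpos_of_nonneg
            (neg_nonpos.2 (hconv θ (Ioc_subset_Icc_self hθ))) (sq_nonneg _)
      _ = (φ' s)⁻¹ - (φ' t)⁻¹ := by
          rw [intervalIntegral.integral_neg,
            intervalIntegral.integral_eq_sub_of_hasDerivAt hinv hcontdiv.intervalIntegrable]
          ring
      _ ≤ 2 / m := by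
          have := abs_le.1 hs
          have := abs_le.1 ht
          rw [show (2 : ℝ) / m = 1 / m + 1 / m by ring]
          linarith
  rw [hleft, hparts]
  calc _ ≤ |(φ' t)⁻¹| + |(φ' s)⁻¹| + 2 / m := by
        refine (norm_sub_le _ _).trans (add_le_add ((norm_sub_le _ _).trans (le_of_eq ?_)) htv)
        rw [norm_mul, hnorm, norm_mul, hnorm, Complex.norm_real, Complex.norm_real, mul_one,
          mul_one, Real.norm_eq_abs, Real.norm_eq_abs]
    _ ≤ 1 / m + 1 / m + 2 / m := by gcongr
    _ = 4 / m := by ring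

theorem continuous_cexp_cubic_phase (κ w : ℝ) :
    Continuous fun θ : ℝ => Complex.exp (I * ((κ * θ ^ 3 - w * θ : ℝ) : ℂ)) := by
  fun_prop

/-- Incomplete Airy integrals from the origin, in the oscillating regime. -/
theorem norm_integral_cubic_phase_le_of_nonneg {κ w ρ : ℝ} (hρ : 0 < ρ) (hκ : 0 < κ)
    (hw : w = 3 * κ * ρ ^ 2) {v : ℝ} (hv : 0 ≤ v) :
    ‖∫ θ in (0 : ℝ)..v, Complex.exp (I * ((κ * θ ^ 3 - w * θ : ℝ) : ℂ))‖
      ≤ 5 / Real.sqrt (κ * ρ) := by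
  -- Here `ρ` is the positive stationary point. The width `ε` balances the trivial bound `2ε` near
  -- `ρ` with the first derivative bound `4 / (3κρε)` away from it.
  set ε : ℝ := 1 / Real.sqrt (κ * ρ) with hε
  have hsq : 0 < Real.sqrt (κ * ρ) := Real.sqrt_pos.2 (by positivity)
  have hε0 : 0 < ε := by positivity
  have hεsq : κ * ρ * ε ^ 2 = 1 := by
    rw [hε, div_pow, Real.sq_sqrt (by positivity), one_pow]
    field_simp
  have hfar : ∀ s t : ℝ, s ≤ t → 0 ≤ s → (∀ θ ∈ Icc s t, ε ≤ |θ - ρ|) →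
      ‖∫ θ in s..t, Complex.exp (I * ((κ * θ ^ 3 - w * θ : ℝ) : ℂ))‖ ≤ 4 / 3 * ε := by
    intro s t hst hs hfar
    have h := norm_integral_cexp_phase_le (φ := fun θ => κ * θ ^ 3 - w * θ)
      (φ' := fun θ => 3 * κ * θ ^ 2 - w) (φ'' := fun θ => 6 * κ * θ) (m := 3 * κ * ρ * ε) hst
      (by positivity)
      (fun θ => by
        refine (((hasDerivAt_pow 3 θ).const_mul κ).sub
          ((hasDerivAt_id θ).const_mul w)).congr_deriv ?_
        push_cast; ring)
      (fun θ => by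
        refine (((hasDerivAt_pow 2 θ).const_mul (3 * κ)).sub_const w).congr_deriv ?_
        push_cast; ring)
      (by fun_prop)
      (fun θ hθ => by
        have h1 : 3 * κ * θ ^ 2 - w = 3 * κ * (θ + ρ) * (θ - ρ) := by rw [hw]; ring
        have h2 : 0 ≤ θ := hs.trans hθ.1
        rw [h1, abs_mul, abs_of_nonneg (by positivity : 0 ≤ 3 * κ * (θ + ρ))]
        have := hfar θ hθ
        gcongr
        linarith)
      (fun θ hθ => by have : 0 ≤ θ := hs.trans hθ.1
                      positivity)
    refine h.trans (le_of_eq ?_)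
    rw [div_eq_iff (by positivity)]
    linear_combination (-4) * hεsq
  -- The cut points are clamped to `[0, v]`, so that one decomposition serves every position of `v`
  -- and also the case `ρ < ε`.
  have hzero : ‖∫ θ in (0 : ℝ)..min v (max 0 (ρ - ε)),
      Complex.exp (I * ((κ * θ ^ 3 - w * θ : ℝ) : ℂ))‖ ≤ 4 / 3 * ε := by
    rcases le_total (ρ - ε) 0 with h | h
    · rw [max_eq_left h, min_eq_right hv, intervalIntegral.integral_same, norm_zero]
      positivity
    · rw [max_eq_right h]
      refine hfar _ _ (le_min hv h) le_rfl fun θ hθ => ?_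
      have := hθ.2.trans (min_le_right _ _)
      rw [abs_sub_comm]
      exact (by linarith : ε ≤ ρ - θ).trans (le_abs_self _)
  have hmid : ‖∫ θ in min v (max 0 (ρ - ε))..min v (ρ + ε),
      Complex.exp (I * ((κ * θ ^ 3 - w * θ : ℝ) : ℂ))‖ ≤ 2 * ε := by
    refine (intervalIntegral.norm_integral_le_of_norm_le_const (C := 1) fun θ _ => ?_).trans ?_
    · rw [mul_comm, Complex.norm_exp_ofReal_mul_I]
    · rw [one_mul, abs_of_nonneg]
      · rcases le_total v (max 0 (ρ - ε)) with h | h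
        · rw [min_eq_left h]
          linarith [min_le_left v (ρ + ε)]
        · rw [min_eq_right h]
          linarith [min_le_right v (ρ + ε), le_max_right 0 (ρ - ε)]
      · rw [sub_nonneg]
        exact min_le_min le_rfl (max_le (by positivity) (by linarith))
  have hlast : ‖∫ θ in min v (ρ + ε)..v,
      Complex.exp (I * ((κ * θ ^ 3 - w * θ : ℝ) : ℂ))‖ ≤ 4 / 3 * ε := by
    rcases le_total v (ρ + ε) with h | h
    · rw [min_eq_left h, intervalIntegral.integral_same, norm_zero]
      positivity
    · rw [min_eq_right h]
      refine hfar _ _ h (by positivity) fun θ hθ => ?_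
      exact (by linarith [hθ.1] : ε ≤ θ - ρ).trans (le_abs_self _)
  have hii := fun s t => (continuous_cexp_cubic_phase κ w).intervalIntegrable (μ := volume) s t
  rw [← intervalIntegral.integral_add_adjacent_intervals (hii 0 (min v (ρ + ε))) (hii _ v),
    ← intervalIntegral.integral_add_adjacent_intervals (hii 0 (min v (max 0 (ρ - ε)))) (hii _ _)]
  calc _ ≤ 4 / 3 * ε + 2 * ε + 4 / 3 * ε :=
        (norm_add_le _ _).trans (add_le_add ((norm_add_le _ _).trans (add_le_add hzero hmid)) hlast)
    _ ≤ 5 * ε := by linarith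
    _ = _ := by rw [hε]; ring

/-- The phase is odd, so reflecting the interval conjugates the integrand. -/
theorem norm_integral_cubic_phase_neg (κ w v : ℝ) :
    ‖∫ θ in (0 : ℝ)..-v, Complex.exp (I * ((κ * θ ^ 3 - w * θ : ℝ) : ℂ))‖
      = ‖∫ θ in (0 : ℝ)..v, Complex.exp (I * ((κ * θ ^ 3 - w * θ : ℝ) : ℂ))‖ := by
  have h1 : ∫ θ in (0 : ℝ)..v, Complex.exp (I * ((κ * θ ^ 3 - w * θ : ℝ) : ℂ))
      = ∫ θ in (-v)..(-0 : ℝ), Complex.exp (I * ((κ * (-θ) ^ 3 - w * (-θ) : ℝ) : ℂ)) := by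
    rw [← intervalIntegral.integral_comp_neg
      (fun θ : ℝ => Complex.exp (I * ((κ * (-θ) ^ 3 - w * (-θ) : ℝ) : ℂ)))]
    simp
  have h2 : ∀ θ : ℝ, Complex.exp (I * ((κ * (-θ) ^ 3 - w * (-θ) : ℝ) : ℂ))
      = (starRingEnd ℂ) (Complex.exp (I * ((κ * θ ^ 3 - w * θ : ℝ) : ℂ))) := fun θ => by
    rw [← Complex.exp_conj, map_mul, Complex.conj_I, Complex.conj_ofReal]
    congr 1
    push_cast
    ring
  rw [h1, neg_zero, intervalIntegral.integral_symm, norm_neg]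
  simp_rw [h2]
  rw [intervalIntegral.intervalIntegral_eq_integral_uIoc,
    intervalIntegral.intervalIntegral_eq_integral_uIoc, integral_conj, norm_smul, norm_smul,
    RCLike.norm_conj]

/-- The stationary point is `ρ = √(w / (3κ))`, hence `κρ = √(κw/3)` and the nested square roots.
Uniformity in `v` makes this a bounded primitive for integration by parts. -/
theorem norm_integral_cubic_phase_le {κ w : ℝ} (hκ : 0 < κ) (hw : 0 < w) (v : ℝ) :
    ‖∫ θ in (0 : ℝ)..v, Complex.exp (I * ((κ * θ ^ 3 - w * θ : ℝ) : ℂ))‖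
      ≤ 5 / Real.sqrt (Real.sqrt (κ * w / 3)) := by
  have hρ : 0 < Real.sqrt (w / (3 * κ)) := Real.sqrt_pos.2 (by positivity)
  have h1 : κ * Real.sqrt (w / (3 * κ)) = Real.sqrt (κ * w / 3) := by
    rw [show κ * w / 3 = κ ^ 2 * (w / (3 * κ)) by field_simp, Real.sqrt_mul (by positivity),
      Real.sqrt_sq hκ.le]
  have hw' : w = 3 * κ * Real.sqrt (w / (3 * κ)) ^ 2 := by
    rw [Real.sq_sqrt (by positivity)]
    field_simp
  rw [← h1]
  rcases le_total 0 v with hv | hv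
  · exact norm_integral_cubic_phase_le_of_nonneg hρ hκ hw' hv
  · rw [← norm_integral_cubic_phase_neg]
    exact norm_integral_cubic_phase_le_of_nonneg hρ hκ hw' (neg_nonneg.2 hv)

/-- Integration by parts against an oscillating factor with bounded primitive. -/
theorem norm_integral_mul_le_of_primitive_le {g A A' : ℝ → ℂ} {S : ℝ} (hg : Continuous g)
    (hg1 : ∀ θ, ‖g θ‖ ≤ 1) (hS : ∀ v, ‖∫ θ in (0 : ℝ)..v, g θ‖ ≤ S)
    (hA : ∀ θ, HasDerivAt A (A' θ) θ) (hAi : Integrable A) (hA'i : Integrable A') :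
    ‖∫ θ, A θ * g θ‖ ≤ S * ∫ θ, ‖A' θ‖ := by
  have hF : ∀ v, HasDerivAt (fun v => ∫ θ in (0 : ℝ)..v, g θ) (g v) v := fun v =>
    intervalIntegral.integral_hasDerivAt_right (hg.intervalIntegrable _ _)
      hg.stronglyMeasurable.stronglyMeasurableAtFilter hg.continuousAt
  have hFc : Continuous fun v => ∫ θ in (0 : ℝ)..v, g θ :=
    continuous_iff_continuousAt.2 fun v => (hF v).continuousAt
  have hparts := integral_mul_deriv_eq_deriv_mul_of_integrable (fun θ _ => hA θ)
    (fun θ _ => hF θ)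
    (hAi.mul_bdd (c := 1) hg.aestronglyMeasurable (Eventually.of_forall hg1))
    (hA'i.mul_bdd (c := S) hFc.aestronglyMeasurable (Eventually.of_forall hS))
    (hAi.mul_bdd (c := S) hFc.aestronglyMeasurable (Eventually.of_forall hS))
  rw [hparts, norm_neg, ← integral_const_mul]
  refine norm_integral_le_of_norm_le (hA'i.norm.const_mul S) (Eventually.of_forall fun θ => ?_)
  rw [norm_mul, mul_comm]
  gcongr
  exact hS θ

/-! ### The line integrals: size of the integrand and freedom of the abscissa -/

/-- The exponential `exp (x τ - a y τ³ - b y τ⁴)`. -/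
noncomputable def quarticExp (a b x y : ℝ) (τ : ℂ) : ℂ :=
  Complex.exp (x * τ - a * y * τ ^ 3 - b * y * τ ^ 4)

/-- The integral of `τ ^ p * quarticExp a b x y τ` along the line of abscissa `η`. -/
noncomputable def lineIntegral (a b : ℝ) (p : ℕ) (x y η : ℝ) : ℂ :=
  ∫ θ : ℝ, ((η : ℂ) + θ * I) ^ p * quarticExp a b x y (η + θ * I)

theorem quarticExp_line (a b x y η θ : ℝ) :
    quarticExp a b x y (η + θ * I) =
      Complex.exp (((x * η - a * y * (η ^ 3 - 3 * η * θ ^ 2)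
          - b * y * (η ^ 4 - 6 * η ^ 2 * θ ^ 2 + θ ^ 4) : ℝ) : ℂ)
        + ((x * θ - a * y * (3 * η ^ 2 * θ - θ ^ 3)
          - b * y * (4 * η ^ 3 * θ - 4 * η * θ ^ 3) : ℝ) : ℂ) * I) := by
  have h2 : I ^ 2 = -1 := Complex.I_sq
  have h3 : I ^ 3 = -I := by rw [pow_succ, h2]; ring
  have h4 : I ^ 4 = 1 := Complex.I_pow_four
  rw [quarticExp]
  congr 1
  push_cast
  ring_nf
  rw [h2, h3, h4]
  ring

theorem norm_quarticExp_line (a b x y η θ : ℝ) :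
    ‖quarticExp a b x y (η + θ * I)‖ = Real.exp (x * η - a * y * (η ^ 3 - 3 * η * θ ^ 2)
      - b * y * (η ^ 4 - 6 * η ^ 2 * θ ^ 2 + θ ^ 4)) := by
  rw [quarticExp_line, Complex.norm_exp, Complex.add_re, Complex.ofReal_re, Complex.re_ofReal_mul,
    Complex.I_re, mul_zero, add_zero]

theorem differentiable_quarticExp (a b x y : ℝ) : Differentiable ℂ (quarticExp a b x y) := by
  unfold quarticExp
  fun_prop

theorem continuous_quarticExp (a b x y : ℝ) : Continuous (quarticExp a b x y) :=
  (differentiable_quarticExp a b x y).continuous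

/-- The growth rate of `quarticExp` in the abscissa. -/
noncomputable def growthRate (a b : ℝ) : ℝ := |a| + 9 * a ^ 2 / b + 36 * b

theorem growthRate_pos {a b : ℝ} (hb : 0 < b) : 0 < growthRate a b := by
  unfold growthRate
  positivity

/-- By Young's inequality, each of the cross terms `3aηθ²` and `6bη²θ²` costs `bθ⁴/4`. Half of the
quartic dissipation is left, written `2 (b/4)` because half of it again will absorb the powers of
`τ`. -/
theorem norm_quarticExp_le (a : ℝ) {b : ℝ} (hb : 0 < b) (x u η θ : ℝ) :
    ‖quarticExp a b x (u ^ 4) (η + θ * I)‖ ≤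
      Real.exp (x * η + growthRate a b * u ^ 4 * (η ^ 2 + η ^ 4) - 2 * (b / 4) * (u * θ) ^ 4) := by
  rw [norm_quarticExp_line, Real.exp_le_exp]
  have h1 : -a * η ^ 3 ≤ |a| * (η ^ 2 + η ^ 4) := by
    have h : -a * η ^ 3 ≤ |a| * |η ^ 3| := by
      rw [← abs_mul]
      exact (le_abs_self _).trans (by rw [neg_mul, abs_neg])
    have h' : |η ^ 3| ≤ η ^ 2 + η ^ 4 := by
      rw [abs_le]
      constructor <;> nlinarith [sq_nonneg (η * (η + 1)), sq_nonneg (η * (η - 1)),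
        sq_nonneg η, sq_nonneg (η ^ 2)]
    exact h.trans (mul_le_mul_of_nonneg_left h' (abs_nonneg a))
  have h2 : 3 * a * η * θ ^ 2 ≤ b / 4 * θ ^ 4 + 9 * a ^ 2 / b * η ^ 2 := by
    have h : b / 4 * θ ^ 4 + 9 * a ^ 2 / b * η ^ 2 - 3 * a * η * θ ^ 2
        = (b * θ ^ 2 / 2 - 3 * a * η) ^ 2 / b := by field_simp; ring
    have : 0 ≤ (b * θ ^ 2 / 2 - 3 * a * η) ^ 2 / b := by positivity
    linarith
  have h3 : 6 * b * η ^ 2 * θ ^ 2 ≤ b / 4 * θ ^ 4 + 36 * b * η ^ 4 := by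
    nlinarith [mul_nonneg hb.le (sq_nonneg (θ ^ 2 / 2 - 6 * η ^ 2))]
  have h4 : 0 ≤ 9 * a ^ 2 / b * η ^ 4 := by positivity
  have h5 : 0 ≤ b * (η ^ 4 + 36 * η ^ 2) := by positivity
  have key : -a * η ^ 3 + 3 * a * η * θ ^ 2 - b * (η ^ 4 - 6 * η ^ 2 * θ ^ 2 + θ ^ 4)
      ≤ growthRate a b * (η ^ 2 + η ^ 4) - b / 2 * θ ^ 4 := by
    unfold growthRate
    linarith
  nlinarith [mul_le_mul_of_nonneg_left key (by positivity : 0 ≤ u ^ 4)]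

/-- To the left of the axis the cubic term contributes `-3ahθ²`. The quartic one contributes
`6bh²θ²`, at most half as much when `4bh ≤ a`, so a Gaussian survives. -/
theorem norm_quarticExp_le_gaussian {a b : ℝ} (hb : 0 < b) (x u : ℝ) {h : ℝ}
    (hh : 0 ≤ h) (hh' : 4 * b * h ≤ a) (θ : ℝ) :
    ‖quarticExp a b x (u ^ 4) (((-h : ℝ) : ℂ) + θ * I)‖ ≤
      Real.exp (-x * h + a * u ^ 4 * h ^ 3 - 3 / 2 * a * u ^ 4 * h * θ ^ 2
        - 2 * (b / 4) * (u * θ) ^ 4) := by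
  rw [norm_quarticExp_line, Real.exp_le_exp]
  have h1 : 0 ≤ (a - 4 * b * h) * (3 / 2 * h * θ ^ 2) :=
    mul_nonneg (by linarith) (by positivity)
  have h2 : 0 ≤ b * h ^ 4 := by positivity
  have h3 : 0 ≤ b * θ ^ 4 := by positivity
  nlinarith [mul_nonneg (by positivity : 0 ≤ u ^ 4) h1, mul_nonneg (by positivity : 0 ≤ u ^ 4) h2,
    mul_nonneg (by positivity : 0 ≤ u ^ 4) h3]

theorem exists_norm_pow_mul_le (p : ℕ) {b : ℝ} (hb : 0 < b) :
    ∃ C : ℝ, 0 < C ∧ ∀ (u η θ D : ℝ) (z : ℂ), 0 < u →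
      ‖z‖ ≤ Real.exp (D - 2 * (b / 4) * (u * θ) ^ 4) →
      ‖((η : ℂ) + θ * I) ^ p * z‖ ≤
        C * ((1 + u * |η|) / u) ^ p * Real.exp D * Real.exp (-(b / 4) * (u * θ) ^ 4) := by
  obtain ⟨C, hC, h⟩ := exists_norm_pow_mul_exp_le p (q := b / 4) (by positivity)
  refine ⟨C, hC, fun u η θ D z hu hz => ?_⟩
  calc ‖((η : ℂ) + θ * I) ^ p * z‖ = ‖(η : ℂ) + θ * I‖ ^ p * ‖z‖ := by rw [norm_mul, norm_pow]
    _ ≤ ‖(η : ℂ) + θ * I‖ ^ p * Real.exp (D - 2 * (b / 4) * (u * θ) ^ 4) := by gcongr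
    _ = (‖(η : ℂ) + θ * I‖ ^ p * Real.exp (-(2 * (b / 4)) * (u * θ) ^ 4)) * Real.exp D := by
        rw [sub_eq_add_neg, Real.exp_add]; ring_nf
    _ ≤ (C * ((1 + u * |η|) / u) ^ p * Real.exp (-(b / 4) * (u * θ) ^ 4)) * Real.exp D := by
        exact mul_le_mul_of_nonneg_right (h u η θ hu) (Real.exp_pos _).le
    _ = _ := by ring

/-- Serves to trade fractional powers for integer ones: with `y = v ^ 12`, the powers `1/2`, `1/3`
and `1/4` of `y` become `v ^ 6`, `v ^ 4` and `v ^ 3`. -/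
theorem exists_pow_eq {y : ℝ} (hy : 0 < y) {n : ℕ} (hn : n ≠ 0) : ∃ v : ℝ, 0 < v ∧ v ^ n = y :=
  ⟨y ^ (1 / n : ℝ), by positivity, by
    rw [← Real.rpow_natCast, ← Real.rpow_mul hy.le, one_div, inv_mul_cancel₀ (by positivity),
      Real.rpow_one]⟩

/-- Uniform domination of the integrands on a strip. -/
theorem exists_norm_pow_mul_quarticExp_le (a : ℝ) {b : ℝ} (hb : 0 < b) (p : ℕ) :
    ∃ C : ℝ, 0 < C ∧ ∀ x u η θ : ℝ, 0 < u →
      ‖((η : ℂ) + θ * I) ^ p * quarticExp a b x (u ^ 4) (η + θ * I)‖ ≤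
        C * ((1 + u * |η|) / u) ^ p *
          Real.exp (x * η + growthRate a b * u ^ 4 * (η ^ 2 + η ^ 4)) *
          Real.exp (-(b / 4) * (u * θ) ^ 4) := by
  obtain ⟨C, hC, h⟩ := exists_norm_pow_mul_le p hb
  exact ⟨C, hC, fun x u η θ hu => h u η θ _ _ hu (norm_quarticExp_le a hb x u η θ)⟩

theorem integrable_pow_mul_quarticExp (a : ℝ) {b : ℝ} (hb : 0 < b) (p : ℕ) (x : ℝ) {y : ℝ}
    (hy : 0 < y) (η : ℝ) :
    Integrable fun θ : ℝ => ((η : ℂ) + θ * I) ^ p * quarticExp a b x y (η + θ * I) := by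
  obtain ⟨u, hu, rfl⟩ := exists_pow_eq hy (n := 4) (by norm_num)
  obtain ⟨C, hC, h⟩ := exists_norm_pow_mul_quarticExp_le a hb p
  have hc := continuous_quarticExp a b x (u ^ 4)
  exact ((integrable_exp_neg_mul_scaled_pow_four (q := b / 4) (by positivity) hu).const_mul _).mono'
    (Continuous.aestronglyMeasurable (by fun_prop)) (Eventually.of_forall fun θ => h x u η θ hu)

theorem tendsto_exp_neg_mul_scaled_pow_four {q u : ℝ} (hq : 0 < q) (hu : 0 < u) {l : Filter ℝ}
    (hl : Tendsto (fun θ : ℝ => |θ|) l atTop) :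
    Tendsto (fun θ : ℝ => Real.exp (-q * (u * θ) ^ 4)) l (𝓝 0) := by
  refine Real.tendsto_exp_atBot.comp ?_
  have h1 : Tendsto (fun θ : ℝ => (u * |θ|) ^ 4) l atTop :=
    (tendsto_pow_atTop (by norm_num)).comp (hl.const_mul_atTop hu)
  have h2 : Tendsto (fun θ : ℝ => -q * (u * |θ|) ^ 4) l atBot :=
    h1.const_mul_atTop_of_neg (by linarith)
  refine h2.congr fun θ => ?_
  rw [mul_pow, mul_pow, ← abs_pow, abs_of_nonneg (by positivity : (0:ℝ) ≤ θ ^ 4)]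

theorem lineIntegral_eq (a : ℝ) {b : ℝ} (hb : 0 < b) (p : ℕ) (x : ℝ) {y : ℝ} (hy : 0 < y)
    (η₁ η₂ : ℝ) : lineIntegral a b p x y η₁ = lineIntegral a b p x y η₂ := by
  obtain ⟨u, hu, rfl⟩ := exists_pow_eq hy (n := 4) (by norm_num)
  obtain ⟨C, hC, h⟩ := exists_norm_pow_mul_quarticExp_le a hb p
  have hb4 : 0 < b / 4 := by positivity
  set H := max |η₁| |η₂| with hH
  set M := C * ((1 + u * H) / u) ^ p *
    Real.exp (|x| * H + growthRate a b * u ^ 4 * (H ^ 2 + H ^ 4)) with hM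
  have hd := differentiable_quarticExp a b x (u ^ 4)
  refine integral_vertical_line_eq (f := fun τ => τ ^ p * quarticExp a b x (u ^ 4) τ) (by fun_prop)
    (B := fun θ => M * Real.exp (-(b / 4) * (u * θ) ^ 4))
    ((integrable_exp_neg_mul_scaled_pow_four hb4 hu).const_mul M) ?_ ?_ fun η hη θ => ?_
  · simpa using (tendsto_exp_neg_mul_scaled_pow_four hb4 hu tendsto_abs_atTop_atTop).const_mul M
  · simpa using (tendsto_exp_neg_mul_scaled_pow_four hb4 hu tendsto_abs_atBot_atTop).const_mul M
  · refine (h x u η θ hu).trans ?_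
    have hηH : |η| ≤ H := by
      rw [abs_le]
      have h1 := abs_le.1 (le_max_left |η₁| |η₂|)
      have h2 := abs_le.1 (le_max_right |η₁| |η₂|)
      exact ⟨(le_min h1.1 h2.1).trans hη.1, hη.2.trans (max_le h1.2 h2.2)⟩
    have hK := (growthRate_pos (a := a) hb).le
    have h2 : η ^ 2 ≤ H ^ 2 := by rw [← sq_abs]; gcongr
    have h4 : η ^ 4 ≤ H ^ 4 := by
      rw [← abs_of_nonneg (by positivity : (0:ℝ) ≤ η ^ 4), abs_pow]; gcongr
    have hx : x * η ≤ |x| * H := (le_abs_self _).trans (by rw [abs_mul]; gcongr)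
    rw [hM]
    gcongr

/-- Bound of the line integrals by the quartic dissipation. -/
theorem exists_integral_norm_le (a : ℝ) {b : ℝ} (hb : 0 < b) (p : ℕ) :
    ∃ C : ℝ, 0 < C ∧ ∀ x u η : ℝ, 0 < u →
      ∫ θ : ℝ, ‖((η : ℂ) + θ * I) ^ p * quarticExp a b x (u ^ 4) (η + θ * I)‖ ≤
        C * ((1 + u * |η|) ^ p / u ^ (p + 1)) *
          Real.exp (x * η + growthRate a b * u ^ 4 * (η ^ 2 + η ^ 4)) := by
  obtain ⟨C, hC, h⟩ := exists_norm_pow_mul_quarticExp_le a hb p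
  have hb4 : 0 < b / 4 := by positivity
  refine ⟨C * ∫ θ : ℝ, Real.exp (-(b / 4) * θ ^ 4),
    mul_pos hC (integral_exp_neg_mul_pow_four_pos hb4), fun x u η hu => ?_⟩
  refine (integral_mono (integrable_pow_mul_quarticExp a hb p x (by positivity) η).norm
    ((integrable_exp_neg_mul_scaled_pow_four hb4 hu).const_mul _)
    fun θ => h x u η θ hu).trans (le_of_eq ?_)
  rw [integral_const_mul, integral_exp_neg_mul_scaled_pow_four _ hu, div_pow, pow_succ]
  field_simp
  ring

/-- Bound of the line integrals by the quadratic dissipation on the left of the imaginary axis. -/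
theorem exists_integral_norm_le_gaussian {a b : ℝ} (ha : 0 < a) (hb : 0 < b) (p : ℕ) :
    ∃ C : ℝ, 0 < C ∧ ∀ x u h : ℝ, 0 < u → 0 < h → 4 * b * h ≤ a →
      ∫ θ : ℝ, ‖(((-h : ℝ) : ℂ) + θ * I) ^ p *
          quarticExp a b x (u ^ 4) (((-h : ℝ) : ℂ) + θ * I)‖ ≤
        C * ((1 + u * h) / u) ^ p * (1 / Real.sqrt (u ^ 4 * h)) *
          Real.exp (-x * h + a * u ^ 4 * h ^ 3) := by
  obtain ⟨C, hC, hp⟩ := exists_norm_pow_mul_le p hb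
  refine ⟨C * Real.sqrt (Real.pi / (3 / 2 * a)), by positivity, fun x u h hu hh hh' => ?_⟩
  have hr : 0 < 3 / 2 * a * u ^ 4 * h := by positivity
  have hpt : ∀ θ : ℝ, ‖(((-h : ℝ) : ℂ) + θ * I) ^ p *
      quarticExp a b x (u ^ 4) (((-h : ℝ) : ℂ) + θ * I)‖ ≤
      C * ((1 + u * h) / u) ^ p * Real.exp (-x * h + a * u ^ 4 * h ^ 3) *
        Real.exp (-(3 / 2 * a * u ^ 4 * h) * θ ^ 2) := fun θ => by
    refine (hp u (-h) θ _ _ hu (norm_quarticExp_le_gaussian hb x u hh.le hh' θ)).trans ?_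
    rw [abs_neg, abs_of_pos hh, sub_eq_add_neg _ (3 / 2 * a * u ^ 4 * h * θ ^ 2), Real.exp_add]
    have h1 : Real.exp (-(b / 4) * (u * θ) ^ 4) ≤ 1 := by
      rw [Real.exp_le_one_iff]
      have : 0 ≤ b / 4 * (u * θ) ^ 4 := by positivity
      linarith
    calc _ ≤ C * ((1 + u * h) / u) ^ p * (Real.exp (-x * h + a * u ^ 4 * h ^ 3) *
          Real.exp (-(3 / 2 * a * u ^ 4 * h * θ ^ 2))) * 1 := by gcongr
      _ = _ := by ring_nf
  refine (integral_mono (integrable_pow_mul_quarticExp a hb p x (by positivity) (-h)).norm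
    ((integrable_exp_neg_mul_sq hr).const_mul _) hpt).trans (le_of_eq ?_)
  rw [integral_const_mul, integral_gaussian,
    show Real.pi / (3 / 2 * a * u ^ 4 * h)
      = Real.pi / (3 / 2 * a) * (1 / (u ^ 4 * h)) by field_simp,
    Real.sqrt_mul (by positivity), Real.sqrt_div zero_le_one, Real.sqrt_one]
  ring

/-- On the imaginary axis `θ ↦ -θ` is `τ ↦ -τ`, which flips the odd terms `xτ` and `aτ³` and keeps
the quartic one. This reduces `c₃ < 0` to `c₃ > 0`. -/
theorem lineIntegral_neg (a b : ℝ) (p : ℕ) (x y : ℝ) :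
    lineIntegral (-a) b p (-x) y 0 = (-1) ^ p * lineIntegral a b p x y 0 := by
  unfold lineIntegral
  rw [← integral_neg_eq_self, ← integral_const_mul]
  refine integral_congr_ae (Eventually.of_forall fun θ => ?_)
  simp only [quarticExp]
  rw [← mul_assoc, ← mul_pow]
  congr 1
  · congr 1; push_cast; ring
  · congr 1; push_cast; ring

theorem corrector_eq_lineIntegral (α : ℝ) (p : ℕ) (x y : ℝ) :
    corrector α p x y = 1 / (2 * (Real.pi : ℂ)) * lineIntegral (c₃ α) (c₄ α) p x y 0 := by
  unfold corrector lineIntegral quarticExp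
  congr 1
  refine integral_congr_ae (Eventually.of_forall fun θ => ?_)
  have h3 : I ^ 3 = -I := by rw [pow_succ, Complex.I_sq]; ring
  have h4 : I ^ 4 = 1 := Complex.I_pow_four
  simp only [Complex.ofReal_zero, zero_add]
  rw [mul_assoc, mul_assoc, ← Complex.exp_add, ← Complex.exp_add, mul_comm I (θ : ℂ)]
  congr 2
  rw [mul_pow, mul_pow, h3, h4]
  ring

theorem norm_lineIntegral_le (a b : ℝ) (p : ℕ) (x y η : ℝ) :
    ‖lineIntegral a b p x y η‖ ≤
      ∫ θ : ℝ, ‖((η : ℂ) + θ * I) ^ p * quarticExp a b x y (η + θ * I)‖ :=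
  norm_integral_le_integral_norm _

theorem pow_rpow_eq {v : ℝ} (hv : 0 ≤ v) (n : ℕ) (r : ℝ) (m : ℕ) (h : n * r = m) :
    (v ^ n) ^ r = v ^ m := by
  rw [← Real.rpow_natCast, ← Real.rpow_mul hv, h, Real.rpow_natCast]

/-! ### Regimes without oscillation -/

/-- Decay of the line integrals for `|x| ≥ k y`, on both sides. -/
theorem exists_lineIntegral_le_far (a : ℝ) {b : ℝ} (hb : 0 < b) (p : ℕ) {k : ℝ} (hk : 0 < k) :
    ∃ C c : ℝ, 0 < C ∧ 0 < c ∧ ∀ x y : ℝ, 0 < y → k * y ≤ |x| →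
      ‖lineIntegral a b p x y 0‖ ≤ C / y ^ (((p : ℝ) + 1) / 4)
        * Real.exp (-c * (|x| ^ (4 / 3 : ℝ) / y ^ (1 / 3 : ℝ))) := by
  obtain ⟨C, hC, hint⟩ := exists_integral_norm_le a hb p
  have hK := growthRate_pos (a := a) hb
  set K := growthRate a b
  clear_value K
  obtain ⟨m₀, hm₀, rfl⟩ := exists_pow_eq hk (n := 3) (by norm_num)
  have hden : 0 < 2 * K * (1 / m₀ ^ 2 + 1) := by positivity
  -- Chosen so that the growth `K(δ²m² + δ⁴m⁴)` is at most half of the gain `δm⁴`; the bound `m ≥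
  -- m₀` converts `m²` into `m⁴`. Half of what remains then absorbs the polynomial factor, whence
  -- the final rate `δ/4`.
  set δ := min 1 (1 / (2 * K * (1 / m₀ ^ 2 + 1))) with hδ
  have hδ0 : 0 < δ := lt_min one_pos (by positivity)
  have hδ1 : δ ≤ 1 := min_le_left _ _
  have hδK : δ * (2 * K * (1 / m₀ ^ 2 + 1)) ≤ 1 := by
    rw [← le_div_iff₀ hden]
    exact min_le_right _ _
  clear_value δ
  obtain ⟨C', hC', habs⟩ := exists_one_add_pow_le_exp p (c := δ / 4) (by positivity)
  refine ⟨C * C', δ / 4, by positivity, by positivity, fun x y hy hx => ?_⟩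
  have hx0 : 0 < |x| := lt_of_lt_of_le (by positivity) hx
  obtain ⟨m, hm, hmx⟩ := exists_pow_eq (div_pos hx0 hy) (n := 3) (by norm_num)
  obtain ⟨v, hv, rfl⟩ := exists_pow_eq hy (n := 12) (by norm_num)
  have hxm : |x| = (m * v ^ 4) ^ 3 := by
    rw [eq_div_iff hy.ne'] at hmx
    rw [← hmx]; ring
  have hmm : m₀ ≤ m := by
    have : m₀ ^ 3 ≤ m ^ 3 := by rw [hmx, le_div_iff₀ hy]; exact hx
    exact le_of_pow_le_pow_left₀ (by norm_num) hm.le this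
  have hexp : |x| ^ (4 / 3 : ℝ) / (v ^ 12) ^ (1 / 3 : ℝ) = (v ^ 3 * m) ^ 4 := by
    rw [hxm, pow_rpow_eq (by positivity) 3 _ 4 (by norm_num),
      pow_rpow_eq hv.le 12 _ 4 (by norm_num), div_eq_iff (by positivity)]
    ring
  have hpre : (v ^ 12) ^ (((p : ℝ) + 1) / 4) = (v ^ 3) ^ (p + 1) := by
    rw [← pow_mul, pow_rpow_eq hv.le 12 _ (3 * (p + 1)) (by push_cast; ring)]
  obtain ⟨η, hη, hxη⟩ : ∃ η : ℝ, |η| = δ * m ∧ x * η = -(δ * m * |x|) := by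
    rcases le_total 0 x with h | h
    · exact ⟨-(δ * m), by rw [abs_neg, abs_of_pos (by positivity)], by rw [abs_of_nonneg h]; ring⟩
    · exact ⟨δ * m, abs_of_pos (by positivity), by rw [abs_of_nonpos h]; ring⟩
  have h12 : v ^ 12 = (v ^ 3) ^ 4 := by ring
  rw [hexp, hpre, lineIntegral_eq a hb p x hy 0 η, h12]
  refine (norm_lineIntegral_le _ _ _ _ _ _).trans ((hint x (v ^ 3) η (by positivity)).trans ?_)
  have hexp2 : x * η + K * (v ^ 3) ^ 4 * (η ^ 2 + η ^ 4) ≤ -(δ / 2) * (v ^ 3 * m) ^ 4 := by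
    have h2 : η ^ 2 = δ ^ 2 * m ^ 2 := by rw [← sq_abs, hη]; ring
    have h4 : η ^ 4 = δ ^ 4 * m ^ 4 := by
      rw [show η ^ 4 = (η ^ 2) ^ 2 by ring, h2]; ring
    have hm2 : m ^ 2 ≤ 1 / m₀ ^ 2 * m ^ 4 := by
      rw [div_mul_eq_mul_div, le_div_iff₀ (by positivity), one_mul]
      have : m₀ ^ 2 ≤ m ^ 2 := by gcongr
      calc m ^ 2 * m₀ ^ 2 ≤ m ^ 2 * m ^ 2 := by gcongr
        _ = m ^ 4 := by ring
    have hδ4 : δ ^ 4 * m ^ 4 ≤ δ ^ 2 * m ^ 4 := by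
      gcongr 1
      exact mul_le_mul_of_nonneg_right (pow_le_pow_of_le_one hδ0.le hδ1 (by norm_num))
        (by positivity)
    have hkey : K * (δ ^ 2 * m ^ 2 + δ ^ 4 * m ^ 4) ≤ δ / 2 * m ^ 4 := by
      calc K * (δ ^ 2 * m ^ 2 + δ ^ 4 * m ^ 4)
          ≤ K * (δ ^ 2 * (1 / m₀ ^ 2 * m ^ 4) + δ ^ 2 * m ^ 4) := by gcongr
        _ = (δ * (2 * K * (1 / m₀ ^ 2 + 1))) * (δ / 2 * m ^ 4) := by ring
        _ ≤ 1 * (δ / 2 * m ^ 4) := by gcongr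
        _ = _ := one_mul _
    rw [hxη, hxm, h2, h4]
    linarith [mul_le_mul_of_nonneg_left hkey (by positivity : 0 ≤ (v ^ 3) ^ 4)]
  have hT : (1 + v ^ 3 * |η|) ^ p ≤ C' * Real.exp (δ / 4 * (v ^ 3 * m) ^ 4) := by
    have hz : v ^ 3 * |η| ≤ (v ^ 3 * m) ^ 4 + 1 := by
      have : v ^ 3 * |η| ≤ v ^ 3 * m := by
        rw [hη]
        gcongr
        exact mul_le_of_le_one_left hm.le hδ1
      linarith [sq_nonneg ((v ^ 3 * m) ^ 2 - 1), sq_nonneg (v ^ 3 * m - 1),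
        sq_nonneg ((v ^ 3 * m) ^ 2)]
    exact habs _ _ (by positivity) hz
  calc _ ≤ C * ((C' * Real.exp (δ / 4 * (v ^ 3 * m) ^ 4)) / (v ^ 3) ^ (p + 1)) *
        Real.exp (-(δ / 2) * (v ^ 3 * m) ^ 4) := by gcongr
    _ = C * C' / (v ^ 3) ^ (p + 1) * (Real.exp (δ / 4 * (v ^ 3 * m) ^ 4) *
        Real.exp (-(δ / 2) * (v ^ 3 * m) ^ 4)) := by ring
    _ = _ := by rw [← Real.exp_add]; ring_nf

/-- The transition zone `|x| ≤ M y^{1/3}`. -/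
theorem exists_lineIntegral_le_transition {a b : ℝ} (ha : 0 < a) (hb : 0 < b) (p : ℕ) {ymin : ℝ}
    (hymin : 0 < ymin) {M : ℝ} (hM : 0 < M) :
    ∃ C : ℝ, 0 < C ∧ ∀ x y : ℝ, ymin ≤ y → |x| ≤ M * y ^ (1 / 3 : ℝ) →
      ‖lineIntegral a b p x y 0‖ ≤ C / y ^ ((1 : ℝ) / 3 + (p : ℝ) / 4) := by
  obtain ⟨C, hC, hint⟩ := exists_integral_norm_le_gaussian ha hb p
  obtain ⟨v₀, hv₀, rfl⟩ := exists_pow_eq hymin (n := 12) (by norm_num)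
  -- The abscissa will be `-δ y^{-1/3}`; this `δ` makes `4bh ≤ a` an equality at `y = ymin`, so it
  -- holds for all larger `y`.
  set δ := a * v₀ ^ 4 / (4 * b) with hδ
  have hδ0 : 0 < δ := by positivity
  refine ⟨C * (1 + δ / v₀) ^ p * (1 / Real.sqrt δ) * Real.exp (M * δ + a * δ ^ 3), by positivity,
    fun x y hy hx => ?_⟩
  have hy0 := hymin.trans_le hy
  obtain ⟨v, hv, rfl⟩ := exists_pow_eq hy0 (n := 12) (by norm_num)
  have hvv : v₀ ≤ v := le_of_pow_le_pow_left₀ (by norm_num) hv.le hy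
  rw [pow_rpow_eq hv.le 12 _ 4 (by norm_num)] at hx
  rw [pow_rpow_eq hv.le 12 _ (4 + 3 * p) (by push_cast; ring)]
  set h := δ / v ^ 4 with hh
  have hh0 : 0 < h := by positivity
  have hh' : 4 * b * h ≤ a := by
    rw [hh, hδ, ← mul_div_assoc, div_le_iff₀ (by positivity), mul_div_cancel₀ _ (by positivity)]
    gcongr
  rw [lineIntegral_eq a hb p x hy0 0 (-h), show v ^ 12 = (v ^ 3) ^ 4 by ring]
  refine (norm_lineIntegral_le _ _ _ _ _ _).trans
    ((hint x (v ^ 3) h (by positivity) hh0 hh').trans ?_)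
  have h1 : (1 + v ^ 3 * h) / v ^ 3 ≤ (1 + δ / v₀) / v ^ 3 := by
    gcongr
    rw [hh, show v ^ 3 * (δ / v ^ 4) = δ / v by field_simp]
    gcongr
  have h2 : Real.sqrt ((v ^ 3) ^ 4 * h) = v ^ 4 * Real.sqrt δ := by
    rw [hh, show (v ^ 3) ^ 4 * (δ / v ^ 4) = (v ^ 4) ^ 2 * δ by field_simp,
      Real.sqrt_mul (by positivity), Real.sqrt_sq (by positivity)]
  have h3 : -x * h + a * (v ^ 3) ^ 4 * h ^ 3 ≤ M * δ + a * δ ^ 3 := by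
    have e1 : -x * h ≤ M * δ := by
      calc -x * h ≤ (M * v ^ 4) * h := by
            gcongr
            exact (neg_le_abs x).trans hx
        _ = M * δ := by rw [hh]; field_simp
    have e2 : a * (v ^ 3) ^ 4 * h ^ 3 = a * δ ^ 3 := by rw [hh]; field_simp
    linarith
  rw [h2]
  calc _ ≤ C * ((1 + δ / v₀) / v ^ 3) ^ p * (1 / (v ^ 4 * Real.sqrt δ)) *
        Real.exp (M * δ + a * δ ^ 3) := by gcongr
    _ = _ := by
        rw [div_pow, pow_add, pow_mul]
        field_simp

set_option maxHeartbeats 1000000 in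
/-- The rapidly decaying side `0 ≤ x ≤ k y`. -/
theorem exists_lineIntegral_le_right {a b : ℝ} (ha : 0 < a) (hb : 0 < b) (p : ℕ) {ymin : ℝ}
    (hymin : 0 < ymin) {k : ℝ} (hk : 0 < k) :
    ∃ C c : ℝ, 0 < C ∧ 0 < c ∧ ∀ x y : ℝ, ymin ≤ y → 0 ≤ x → x ≤ k * y →
      ‖lineIntegral a b p x y 0‖ ≤ C / y ^ ((1 : ℝ) / 3 + (p : ℝ) / 4)
        * Real.exp (-c * (x ^ (3 / 2 : ℝ) / y ^ (1 / 2 : ℝ))) := by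
  obtain ⟨C₁, hC₁, htrans⟩ := exists_lineIntegral_le_transition ha hb p hymin one_pos
  obtain ⟨C, hC, hint⟩ := exists_integral_norm_le_gaussian ha hb p
  obtain ⟨v₀, hv₀, rfl⟩ := exists_pow_eq hymin (n := 12) (by norm_num)
  obtain ⟨l, hl, rfl⟩ := exists_pow_eq hk (n := 2) (by norm_num)
  -- The first entry keeps `4bδm ≤ a` for `m = √(x/y) ≤ l`; the other two give `aδ³ ≤ δ/2`, so that
  -- the cubic term eats at most half of the gain.
  set δ := min (a / (4 * b * l)) (min 1 (1 / (2 * a))) with hδ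
  have hδ0 : 0 < δ := lt_min (by positivity) (lt_min one_pos (by positivity))
  have hδ1 : δ ≤ 1 := (min_le_right _ _).trans (min_le_left _ _)
  have hδa : δ * (2 * a) ≤ 1 := by
    rw [← le_div_iff₀ (by positivity)]
    exact (min_le_right _ _).trans (min_le_right _ _)
  have hδl : δ * (4 * b * l) ≤ a := by
    rw [← le_div_iff₀ (by positivity)]
    exact min_le_left _ _
  clear_value δ
  obtain ⟨C', hC', habs⟩ := exists_one_add_pow_le_exp p (c := δ / 4) (by positivity)
  set C₂ := C * (1 + δ / v₀) ^ p * C' * (1 / Real.sqrt δ) with hC₂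
  have hC₂0 : 0 < C₂ := by positivity
  refine ⟨C₁ * Real.exp (δ / 4) + C₂, δ / 4, by positivity, by positivity,
    fun x y hy hx0 hx => ?_⟩
  have hy0 := hymin.trans_le hy
  obtain ⟨v, hv, rfl⟩ := exists_pow_eq hy0 (n := 12) (by norm_num)
  have hvv : v₀ ≤ v := le_of_pow_le_pow_left₀ (by norm_num) hv.le hy
  set m := Real.sqrt (x / v ^ 12) with hm
  have hm0 : 0 ≤ m := Real.sqrt_nonneg _
  have hxm : x = (v ^ 6 * m) ^ 2 := by
    rw [mul_pow, hm, Real.sq_sqrt (by positivity)]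
    field_simp
  have hml : m ≤ l := by
    rw [hm, Real.sqrt_le_left hl.le, div_le_iff₀ hy0]
    exact hx
  clear_value m C₂
  have hZ : x ^ (3 / 2 : ℝ) / (v ^ 12) ^ (1 / 2 : ℝ) = (v ^ 4 * m) ^ 3 := by
    rw [hxm, pow_rpow_eq (by positivity) 2 _ 3 (by norm_num),
      pow_rpow_eq hv.le 12 _ 6 (by norm_num), div_eq_iff (by positivity)]
    ring
  rw [hZ]
  -- The quantity `v⁴m` is the cube root of `x^{3/2}/y^{1/2}`. If it is at most `1`, then `x ≤
  -- y^{1/3}`: the transition bound applies and the exponential is bounded below.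
  rcases le_total (v ^ 4 * m) 1 with hZ1 | hZ1
  · have h1 := htrans x (v ^ 12) hy (by
      rw [abs_of_nonneg hx0, one_mul, pow_rpow_eq hv.le 12 _ 4 (by norm_num), hxm]
      calc (v ^ 6 * m) ^ 2 = v ^ 4 * (v ^ 4 * m) ^ 2 := by ring
        _ ≤ v ^ 4 * 1 ^ 2 := by gcongr
        _ = v ^ 4 := by ring)
    refine h1.trans ?_
    have h2 : 1 ≤ Real.exp (δ / 4) * Real.exp (-(δ / 4) * (v ^ 4 * m) ^ 3) := by
      rw [← Real.exp_add, Real.one_le_exp_iff]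
      have : δ / 4 * (v ^ 4 * m) ^ 3 ≤ δ / 4 :=
        mul_le_of_le_one_right (by positivity) (pow_le_one₀ (by positivity) hZ1)
      linarith
    set P := (v ^ 12) ^ ((1 : ℝ) / 3 + (p : ℝ) / 4) with hP
    have hP0 : 0 < P := by positivity
    calc C₁ / P ≤ C₁ / P * (Real.exp (δ / 4) * Real.exp (-(δ / 4) * (v ^ 4 * m) ^ 3)) :=
          le_mul_of_one_le_right (by positivity) h2
      _ = C₁ * Real.exp (δ / 4) / P * Real.exp (-(δ / 4) * (v ^ 4 * m) ^ 3) := by ring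
      _ ≤ _ := by
          gcongr
          linarith
  · have hmpos : 0 < m := by
      by_contra h
      have : m = 0 := le_antisymm (not_lt.1 h) hm0
      rw [this, mul_zero] at hZ1
      linarith
    rw [pow_rpow_eq hv.le 12 _ (4 + 3 * p) (by push_cast; ring)]
    have hh' : 4 * b * (δ * m) ≤ a := by
      calc 4 * b * (δ * m) ≤ 4 * b * (δ * l) := by gcongr
        _ = δ * (4 * b * l) := by ring
        _ ≤ a := hδl
    rw [lineIntegral_eq a hb p x hy0 0 (-(δ * m)), show v ^ 12 = (v ^ 3) ^ 4 by ring]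
    refine (norm_lineIntegral_le _ _ _ _ _ _).trans
      ((hint x (v ^ 3) (δ * m) (by positivity) (by positivity) hh').trans ?_)
    have h1 : 1 + v ^ 3 * (δ * m) ≤ (1 + δ / v₀) * (1 + v ^ 4 * m) := by
      have e1 : v ^ 3 * (δ * m) = δ / v * (v ^ 4 * m) := by field_simp
      have e2 : δ / v ≤ δ / v₀ := by gcongr
      have e3 : 0 ≤ δ / v₀ := by positivity
      have e4 : 0 ≤ v ^ 4 * m := by positivity
      rw [e1, show (1 + δ / v₀) * (1 + v ^ 4 * m)
        = 1 + v ^ 4 * m + δ / v₀ + δ / v₀ * (v ^ 4 * m) by ring]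
      linarith [mul_le_mul_of_nonneg_right e2 e4]
    have h2 : (1 + v ^ 4 * m) ^ p ≤ C' * Real.exp (δ / 4 * (v ^ 4 * m) ^ 3) :=
      habs _ _ (by positivity) (by
        have := le_self_pow₀ hZ1 (show 3 ≠ 0 by norm_num)
        linarith)
    -- Since `v⁴m ≥ 1`, the Gaussian on this line has width at most of order `y^{-1/3}`.
    have h3 : v ^ 4 * Real.sqrt δ ≤ Real.sqrt ((v ^ 3) ^ 4 * (δ * m)) := by
      rw [show v ^ 4 * Real.sqrt δ = Real.sqrt ((v ^ 4) ^ 2 * δ) by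
        rw [Real.sqrt_mul (by positivity), Real.sqrt_sq (by positivity)]]
      apply Real.sqrt_le_sqrt
      calc (v ^ 4) ^ 2 * δ = v ^ 8 * δ * 1 := by ring
        _ ≤ v ^ 8 * δ * (v ^ 4 * m) := by gcongr
        _ = _ := by ring
    have h4 : -x * (δ * m) + a * (v ^ 3) ^ 4 * (δ * m) ^ 3 ≤ -(δ / 2) * (v ^ 4 * m) ^ 3 := by
      have e1 : a * δ ^ 3 ≤ δ / 2 := by
        calc a * δ ^ 3 = δ * (2 * a) * (δ ^ 2 / 2) := by ring
          _ ≤ 1 * (δ / 2) := by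
              gcongr
              exact pow_le_of_le_one hδ0.le hδ1 two_ne_zero
          _ = δ / 2 := one_mul _
      have e2 : 0 ≤ (v ^ 4 * m) ^ 3 := by positivity
      have e3 : -x * (δ * m) + a * (v ^ 3) ^ 4 * (δ * m) ^ 3
          = (-δ + a * δ ^ 3) * (v ^ 4 * m) ^ 3 := by rw [hxm]; ring
      rw [e3]
      exact mul_le_mul_of_nonneg_right (by linarith) e2
    have g1 : ((1 + v ^ 3 * (δ * m)) / v ^ 3) ^ p ≤ ((1 + δ / v₀) * (1 + v ^ 4 * m) / v ^ 3) ^ p :=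
      pow_le_pow_left₀ (by positivity) (div_le_div_of_nonneg_right h1 (by positivity)) p
    have g2 : 1 / Real.sqrt ((v ^ 3) ^ 4 * (δ * m)) ≤ 1 / (v ^ 4 * Real.sqrt δ) :=
      one_div_le_one_div_of_le (by positivity) h3
    calc _ ≤ C * ((1 + δ / v₀) * (1 + v ^ 4 * m) / v ^ 3) ^ p * (1 / (v ^ 4 * Real.sqrt δ)) *
          Real.exp (-(δ / 2) * (v ^ 4 * m) ^ 3) :=
          mul_le_mul (mul_le_mul (mul_le_mul_of_nonneg_left g1 hC.le) g2 (by positivity)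
            (by positivity)) (Real.exp_le_exp.2 h4) (Real.exp_pos _).le (by positivity)
      _ = C * (1 + δ / v₀) ^ p * (1 + v ^ 4 * m) ^ p * (1 / Real.sqrt δ) / v ^ (4 + 3 * p) *
          Real.exp (-(δ / 2) * (v ^ 4 * m) ^ 3) := by
          rw [div_pow, mul_pow, pow_add, pow_mul]
          field_simp
      _ ≤ C * (1 + δ / v₀) ^ p * (C' * Real.exp (δ / 4 * (v ^ 4 * m) ^ 3)) * (1 / Real.sqrt δ)
          / v ^ (4 + 3 * p) * Real.exp (-(δ / 2) * (v ^ 4 * m) ^ 3) := by gcongr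
      _ = C₂ / v ^ (4 + 3 * p) * (Real.exp (δ / 4 * (v ^ 4 * m) ^ 3) *
          Real.exp (-(δ / 2) * (v ^ 4 * m) ^ 3)) := by rw [hC₂]; ring
      _ = C₂ / v ^ (4 + 3 * p) * Real.exp (-(δ / 4) * (v ^ 4 * m) ^ 3) := by
          rw [← Real.exp_add]; ring_nf
      _ ≤ _ := by
          gcongr
          have : 0 < C₁ * Real.exp (δ / 4) := by positivity
          linarith

/-! ### The oscillating regime -/

/-- `quarticExp` on a vertical line without the cubic phase. -/
noncomputable def amplitudeExp (a b x y η θ : ℝ) : ℂ :=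
  Complex.exp (((x * η - a * y * η ^ 3 + 3 * a * y * η * θ ^ 2 : ℝ) : ℂ)
    - b * y * (η + θ * I) ^ 4)

/-- Only the phase of the linear and cubic terms is split off. The quartic phase stays in the
amplitude, where differentiating it costs just a factor `yτ³`. -/
theorem quarticExp_eq_amplitudeExp_mul (a b x y η θ : ℝ) :
    quarticExp a b x y (η + θ * I) = amplitudeExp a b x y η θ *
      Complex.exp (I * (((a * y) * θ ^ 3 - (-x + 3 * a * y * η ^ 2) * θ : ℝ) : ℂ)) := by
  have h3 : I ^ 3 = -I := by rw [pow_succ, Complex.I_sq]; ring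
  rw [quarticExp, amplitudeExp, ← Complex.exp_add]
  congr 1
  have e : ((η : ℂ) + θ * I) ^ 3 = η ^ 3 + 3 * η ^ 2 * θ * I - 3 * η * θ ^ 2 - θ ^ 3 * I := by
    linear_combination (3 * η * θ ^ 2 : ℂ) * Complex.I_sq + (θ ^ 3 : ℂ) * h3
  rw [e]
  push_cast
  ring

theorem norm_amplitudeExp (a b x y η θ : ℝ) :
    ‖amplitudeExp a b x y η θ‖ = ‖quarticExp a b x y (η + θ * I)‖ := by
  rw [quarticExp_eq_amplitudeExp_mul, norm_mul, mul_comm I, Complex.norm_exp_ofReal_mul_I, mul_one]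

theorem continuous_amplitudeExp (a b x y η : ℝ) : Continuous (amplitudeExp a b x y η) := by
  unfold amplitudeExp
  fun_prop

theorem hasDerivAt_pow_mul_amplitudeExp (a b : ℝ) (p : ℕ) (x y η θ : ℝ) :
    HasDerivAt (fun θ : ℝ => ((η : ℂ) + θ * I) ^ p * amplitudeExp a b x y η θ)
      ((p * ((η : ℂ) + θ * I) ^ (p - 1) * I + ((η : ℂ) + θ * I) ^ p *
        (6 * a * y * η * θ - 4 * b * y * ((η : ℂ) + θ * I) ^ 3 * I))
        * amplitudeExp a b x y η θ) θ := by
  have hid : HasDerivAt (fun θ : ℝ => (θ : ℂ)) 1 θ := (hasDerivAt_id θ).ofReal_comp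
  have hτ : HasDerivAt (fun θ : ℝ => (η : ℂ) + θ * I) I θ := by
    simpa using (hid.mul_const I).const_add (η : ℂ)
  have hre : HasDerivAt (fun θ : ℝ => (x * η - a * y * η ^ 3 + 3 * a * y * η * θ ^ 2 : ℝ))
      (3 * a * y * η * (2 * θ)) θ := by
    refine (((hasDerivAt_pow 2 θ).const_mul (3 * a * y * η)).const_add _).congr_deriv ?_
    push_cast
    ring
  have hexp : HasDerivAt (amplitudeExp a b x y η) (amplitudeExp a b x y η θ *
      (((3 * a * y * η * (2 * θ) : ℝ) : ℂ)
        - b * y * ((4 : ℕ) * ((η : ℂ) + θ * I) ^ (4 - 1) * I))) θ :=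
    (hre.ofReal_comp.sub ((hτ.pow 4).const_mul (b * y : ℂ))).cexp
  refine ((hτ.fun_pow p).fun_mul hexp).congr_deriv ?_
  push_cast
  ring

/-- Because `|θ| ≤ |τ|`, each term of the derivative is dominated by a power of `τ` times the
original exponential, and the absolute bounds on line integrals apply again. -/
theorem norm_deriv_amplitude_le {a b : ℝ} (ha : 0 < a) (hb : 0 < b) (p : ℕ) (x : ℝ) {y η : ℝ}
    (hy : 0 < y) (hη : 0 ≤ η) (θ : ℝ) :
    ‖(p * ((η : ℂ) + θ * I) ^ (p - 1) * I + ((η : ℂ) + θ * I) ^ p *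
        (6 * a * y * η * θ - 4 * b * y * ((η : ℂ) + θ * I) ^ 3 * I))
        * amplitudeExp a b x y η θ‖ ≤
      p * ‖((η : ℂ) + θ * I) ^ (p - 1) * quarticExp a b x y (η + θ * I)‖
      + 6 * a * y * η * ‖((η : ℂ) + θ * I) ^ (p + 1) * quarticExp a b x y (η + θ * I)‖
      + 4 * b * y * ‖((η : ℂ) + θ * I) ^ (p + 3) * quarticExp a b x y (η + θ * I)‖ := by
  have hθ : |θ| ≤ ‖(η : ℂ) + θ * I‖ := by
    simpa using Complex.abs_im_le_norm ((η : ℂ) + θ * I)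
  simp only [norm_mul, norm_pow, norm_amplitudeExp]
  set N := ‖(η : ℂ) + θ * I‖ with hN
  have h1 : ‖(p * ((η : ℂ) + θ * I) ^ (p - 1) * I + ((η : ℂ) + θ * I) ^ p *
      (6 * a * y * η * θ - 4 * b * y * ((η : ℂ) + θ * I) ^ 3 * I))‖ ≤
      p * N ^ (p - 1) + N ^ p * (6 * a * y * η * N + 4 * b * y * N ^ 3) := by
    refine (norm_add_le _ _).trans (add_le_add (le_of_eq ?_) ?_)
    · simp [hN]
    · rw [norm_mul, norm_pow]
      refine mul_le_mul_of_nonneg_left ((norm_sub_le _ _).trans (add_le_add ?_ (le_of_eq ?_)))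
        (by positivity)
      · have : ‖(6 * a * y * η * θ : ℂ)‖ = 6 * a * y * η * |θ| := by
          simp [abs_of_pos ha, abs_of_pos hy, abs_of_nonneg hη]
        rw [this]
        gcongr
      · simp [hN, abs_of_pos hb, abs_of_pos hy]
  calc _ ≤ (p * N ^ (p - 1) + N ^ p * (6 * a * y * η * N + 4 * b * y * N ^ 3)) *
        ‖quarticExp a b x y (η + θ * I)‖ := by gcongr
    _ = _ := by ring

/-- Bound of a line integral by an incomplete Airy integral and the variation of the amplitude. -/
theorem norm_lineIntegral_le_oscillatory {a b : ℝ} (ha : 0 < a) (hb : 0 < b) (p : ℕ) {x y η : ℝ}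
    (hx : x < 0) (hy : 0 < y) (hη : 0 ≤ η) :
    ‖lineIntegral a b p x y η‖ ≤ 5 / Real.sqrt (Real.sqrt (a * y * -x / 3)) *
      (p * (∫ θ : ℝ, ‖((η : ℂ) + θ * I) ^ (p - 1) * quarticExp a b x y (η + θ * I)‖)
      + 6 * a * y * η *
        (∫ θ : ℝ, ‖((η : ℂ) + θ * I) ^ (p + 1) * quarticExp a b x y (η + θ * I)‖)
      + 4 * b * y *
        (∫ θ : ℝ, ‖((η : ℂ) + θ * I) ^ (p + 3) * quarticExp a b x y (η + θ * I)‖)) := by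
  have hi : ∀ q : ℕ, Integrable fun θ : ℝ =>
      ‖((η : ℂ) + θ * I) ^ q * quarticExp a b x y (η + θ * I)‖ := fun q =>
    (integrable_pow_mul_quarticExp a hb q x hy η).norm
  have hw : 0 < -x + 3 * a * y * η ^ 2 := by have : 0 ≤ 3 * a * y * η ^ 2 := by positivity
                                             linarith
  have hc := continuous_amplitudeExp a b x y η
  have hAi : Integrable fun θ : ℝ => ((η : ℂ) + θ * I) ^ p * amplitudeExp a b x y η θ :=
    (hi p).mono' (Continuous.aestronglyMeasurable (by fun_prop)) (Eventually.of_forall fun θ => by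
      rw [norm_mul, norm_mul, norm_amplitudeExp])
  have hdom := (((hi (p - 1)).const_mul (p : ℝ)).add ((hi (p + 1)).const_mul (6 * a * y * η))).add
    ((hi (p + 3)).const_mul (4 * b * y))
  have hbound := fun θ => norm_deriv_amplitude_le ha hb p x hy hη θ
  have hA'i : Integrable fun θ : ℝ =>
      (p * ((η : ℂ) + θ * I) ^ (p - 1) * I + ((η : ℂ) + θ * I) ^ p *
        (6 * a * y * η * θ - 4 * b * y * ((η : ℂ) + θ * I) ^ 3 * I))
        * amplitudeExp a b x y η θ :=
    hdom.mono' (Continuous.aestronglyMeasurable (by fun_prop)) (Eventually.of_forall hbound)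
  have hparts := norm_integral_mul_le_of_primitive_le
    (continuous_cexp_cubic_phase (a * y) (-x + 3 * a * y * η ^ 2))
    (fun θ => by rw [mul_comm I, Complex.norm_exp_ofReal_mul_I])
    (norm_integral_cubic_phase_le (by positivity) hw)
    (hasDerivAt_pow_mul_amplitudeExp a b p x y η) hAi hA'i
  have heq : lineIntegral a b p x y η = ∫ θ : ℝ,
      ((η : ℂ) + θ * I) ^ p * amplitudeExp a b x y η θ * Complex.exp (I *
        (((a * y) * θ ^ 3 - (-x + 3 * a * y * η ^ 2) * θ : ℝ) : ℂ)) := by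
    unfold lineIntegral
    simp_rw [quarticExp_eq_amplitudeExp_mul, mul_assoc]
  rw [heq]
  refine hparts.trans (mul_le_mul ?_ ?_ (integral_nonneg fun _ => norm_nonneg _) (by positivity))
  · have hx' : 0 < -x := by linarith
    gcongr
    have : 0 ≤ 3 * a * y * η ^ 2 := by positivity
    linarith
  · refine (integral_mono hA'i.norm hdom hbound).trans (le_of_eq ?_)
    rw [integral_add' (((hi (p - 1)).const_mul _).add ((hi (p + 1)).const_mul _))
      ((hi (p + 3)).const_mul _), integral_add' ((hi (p - 1)).const_mul _)
      ((hi (p + 1)).const_mul _), integral_const_mul, integral_const_mul, integral_const_mul]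

set_option maxHeartbeats 1000000 in
/-- The oscillating side `-k y ≤ x < 0`. -/
theorem exists_lineIntegral_le_left {a b : ℝ} (ha : 0 < a) (hb : 0 < b) (p : ℕ) {ymin : ℝ}
    (hymin : 0 < ymin) {k : ℝ} (hk : 0 < k) :
    ∃ C c : ℝ, 0 < C ∧ 0 < c ∧ ∀ x y : ℝ, ymin ≤ y → x < 0 → -(k * y) ≤ x →
      ‖lineIntegral a b p x y 0‖ ≤ C / (|x| ^ (1 / 4 : ℝ) * y ^ (((p : ℝ) + 1) / 4))
        * Real.exp (-c * (x ^ 2 / y)) := by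
  obtain ⟨Ca, hCa, hinta⟩ := exists_integral_norm_le a hb (p - 1)
  obtain ⟨Cb, hCb, hintb⟩ := exists_integral_norm_le a hb (p + 1)
  obtain ⟨Cc, hCc, hintc⟩ := exists_integral_norm_le a hb (p + 3)
  have hK := growthRate_pos (a := a) hb
  set K := growthRate a b
  clear_value K
  obtain ⟨u₀, hu₀, rfl⟩ := exists_pow_eq hymin (n := 4) (by norm_num)
  have hden : 0 < 2 * K * (1 + k ^ 2) := by positivity
  -- With `η = δ|x|/y ≤ k`, one has `η⁴ ≤ k²η²`, and this `δ` keeps the growth below half of the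
  -- gain `δx²/y`.
  set δ := min 1 (1 / (2 * K * (1 + k ^ 2))) with hδ
  have hδ0 : 0 < δ := lt_min one_pos (by positivity)
  have hδ1 : δ ≤ 1 := min_le_left _ _
  have hδK : δ * (2 * K * (1 + k ^ 2)) ≤ 1 := by
    rw [← le_div_iff₀ hden]
    exact min_le_right _ _
  clear_value δ
  obtain ⟨C', hC', habs⟩ := exists_one_add_pow_le_exp (p + 3) (c := δ / 4) (by positivity)
  set L := 1 + 1 / u₀ with hL
  have hL1 : 1 ≤ L := by rw [hL]; have : 0 < 1 / u₀ := by positivity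
                         linarith
  set s := Real.sqrt (Real.sqrt (a / 3)) with hs
  have hs0 : 0 < s := Real.sqrt_pos.2 (Real.sqrt_pos.2 (by positivity))
  set Q := p * Ca + 6 * a * Cb + 4 * b * Cc with hQ
  have hQ0 : 0 < Q := by positivity
  clear_value Q
  clear_value s L
  refine ⟨5 / s * (Q * L ^ (p + 3) * C'), δ / 4, by positivity, by positivity,
    fun x y hy hx hxk => ?_⟩
  have hy0 := hymin.trans_le hy
  obtain ⟨u, hu, rfl⟩ := exists_pow_eq hy0 (n := 4) (by norm_num)
  have huu : u₀ ≤ u := le_of_pow_le_pow_left₀ (by norm_num) hu.le hy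
  obtain ⟨t, ht, htx⟩ := exists_pow_eq (show 0 < -x by linarith) (n := 4) (by norm_num)
  set z := t ^ 4 / u ^ 2 with hz
  have hz0 : 0 < z := by positivity
  set η := δ * z / u ^ 2 with hη
  have hη0 : 0 < η := by positivity
  have hzk : z / u ^ 2 ≤ k := by
    rw [hz, div_div, div_le_iff₀ (by positivity), htx]
    calc -x ≤ k * u ^ 4 := by linarith
      _ = _ := by ring
  have hxz : x = -(z * u ^ 2) := by
    rw [hz, div_mul_cancel₀ _ (by positivity), htx]; ring
  have hxu : |x| ^ (1 / 4 : ℝ) = t := by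
    rw [abs_of_neg hx, ← htx, pow_rpow_eq ht.le 4 _ 1 (by norm_num), pow_one]
  have hpre : (u ^ 4) ^ (((p : ℝ) + 1) / 4) = u ^ (p + 1) :=
    pow_rpow_eq hu.le 4 _ (p + 1) (by push_cast; ring)
  have hx2 : x ^ 2 / u ^ 4 = z ^ 2 := by rw [hxz]; field_simp
  have hS : Real.sqrt (Real.sqrt (a * u ^ 4 * -x / 3)) = s * (t * u) := by
    rw [← htx, show a * u ^ 4 * t ^ 4 / 3 = a / 3 * ((t * u) ^ 2) ^ 2 by ring,
      Real.sqrt_mul (by positivity), Real.sqrt_sq (by positivity), Real.sqrt_mul (by positivity),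
      Real.sqrt_sq (by positivity), ← hs]
  clear_value z η
  set E := x * η + K * u ^ 4 * (η ^ 2 + η ^ 4) with hE
  have hexp : E ≤ -(δ / 2) * z ^ 2 := by
    have e1 : η ^ 4 ≤ k ^ 2 * η ^ 2 := by
      have h1 : η ≤ k := by
        calc η = δ * (z / u ^ 2) := by rw [hη]; ring
          _ ≤ 1 * k := by gcongr
          _ = k := one_mul k
      calc η ^ 4 = η ^ 2 * η ^ 2 := by ring
        _ ≤ k ^ 2 * η ^ 2 := by gcongr
    have e2 : x * η = -δ * z ^ 2 := by rw [hxz, hη]; field_simp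
    have e3 : u ^ 4 * η ^ 2 = δ ^ 2 * z ^ 2 := by rw [hη]; field_simp
    have e4 : K * u ^ 4 * (η ^ 2 + η ^ 4) ≤ δ / 2 * z ^ 2 := by
      calc K * u ^ 4 * (η ^ 2 + η ^ 4) ≤ K * u ^ 4 * (η ^ 2 + k ^ 2 * η ^ 2) := by gcongr
        _ = K * (1 + k ^ 2) * (u ^ 4 * η ^ 2) := by ring
        _ = (δ * (2 * K * (1 + k ^ 2))) * (δ / 2 * z ^ 2) := by rw [e3]; ring
        _ ≤ 1 * (δ / 2 * z ^ 2) := by gcongr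
        _ = _ := one_mul _
    rw [hE, e2]
    linarith
  -- A common majorant of `1 + uη` and of `u²η`. All three terms then reduce to `T ^ (p + 3) / u ^
  -- p`, and the power of `1 + z` is absorbed by `exp (δz²/4)`.
  set T := L * (1 + z) with hT
  have hT1 : 1 ≤ T := one_le_mul_of_one_le_of_one_le hL1 (by linarith)
  have hTη : 1 + u * |η| ≤ T := by
    have e1 : u * η = δ * (z / u) := by rw [hη]; field_simp
    have e2 : z / u ≤ z / u₀ := by gcongr
    have e3 : δ * (z / u) ≤ 1 * (z / u₀) := by gcongr
    have e4 : 0 < 1 / u₀ := by positivity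
    have e5 : z / u₀ = 1 / u₀ * z := by ring
    rw [abs_of_pos hη0, e1, hT, hL,
      show (1 + 1 / u₀) * (1 + z) = 1 + z + 1 / u₀ + 1 / u₀ * z by ring]
    linarith
  clear_value T E
  have hJ : ∀ {Cq : ℝ} {q : ℕ}, 0 < Cq →
      (∫ θ : ℝ, ‖((η : ℂ) + θ * I) ^ q * quarticExp a b x (u ^ 4) (η + θ * I)‖ ≤
        Cq * ((1 + u * |η|) ^ q / u ^ (q + 1)) * Real.exp E) →
      ∫ θ : ℝ, ‖((η : ℂ) + θ * I) ^ q * quarticExp a b x (u ^ 4) (η + θ * I)‖ ≤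
        Cq * (T ^ q / u ^ (q + 1)) * Real.exp E := fun hCq h => h.trans (by gcongr)
  have hJa := hJ (q := p - 1) hCa (by rw [hE]; exact hinta x u η hu)
  have hJb := hJ (q := p + 1) hCb (by rw [hE]; exact hintb x u η hu)
  have hJc := hJ (q := p + 3) hCc (by rw [hE]; exact hintc x u η hu)
  have hterm_a : p * (Ca * (T ^ (p - 1) / u ^ (p - 1 + 1)) * Real.exp E) ≤
      p * Ca * (T ^ (p + 3) / u ^ p * Real.exp E) := by
    -- For `p = 0` the truncated exponent `p - 1` is harmless, its coefficient being zero.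
    rcases Nat.eq_zero_or_pos p with rfl | hp
    · simp
    · rw [Nat.sub_add_cancel hp]
      calc p * (Ca * (T ^ (p - 1) / u ^ p) * Real.exp E)
          ≤ p * (Ca * (T ^ (p + 3) / u ^ p) * Real.exp E) := by
            gcongr ?_ * (?_ * (?_ / _) * _)
            exact pow_le_pow_right₀ hT1 (by omega)
        _ = _ := by ring
  have hterm_b : 6 * a * u ^ 4 * η * (Cb * (T ^ (p + 1) / u ^ (p + 1 + 1)) * Real.exp E) ≤
      6 * a * Cb * (T ^ (p + 3) / u ^ p * Real.exp E) := by
    have e1 : u ^ 2 * η ≤ T := by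
      have : u ^ 2 * η = δ * z := by rw [hη]; field_simp
      have h1 : δ * z ≤ 1 * z := by gcongr
      have h2 : 1 * (1 + z) ≤ L * (1 + z) := by gcongr
      rw [this, hT]
      linarith
    calc 6 * a * u ^ 4 * η * (Cb * (T ^ (p + 1) / u ^ (p + 1 + 1)) * Real.exp E)
        = 6 * a * Cb * ((u ^ 2 * η) * T ^ (p + 1) / u ^ p * Real.exp E) := by
          rw [pow_succ u (p + 1), pow_succ u p]
          field_simp
      _ ≤ 6 * a * Cb * (T * T ^ (p + 1) / u ^ p * Real.exp E) := by gcongr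
      _ = 6 * a * Cb * (T ^ (p + 2) / u ^ p * Real.exp E) := by ring
      _ ≤ _ := by
          gcongr 6 * a * Cb * (?_ / _ * _)
          exact pow_le_pow_right₀ hT1 (by omega)
  have hterm_c : 4 * b * u ^ 4 * (Cc * (T ^ (p + 3) / u ^ (p + 3 + 1)) * Real.exp E) =
      4 * b * Cc * (T ^ (p + 3) / u ^ p * Real.exp E) := by
    rw [show u ^ (p + 3 + 1) = u ^ p * u ^ 4 by ring]
    field_simp
  have hosc := norm_lineIntegral_le_oscillatory ha hb p hx hy0 hη0.le
  rw [hS] at hosc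
  rw [lineIntegral_eq a hb p x hy0 0 η, hxu, hpre, hx2]
  have hz2 : (1 + z) ^ (p + 3) ≤ C' * Real.exp (δ / 4 * z ^ 2) :=
    habs _ _ hz0.le (by linarith [sq_nonneg (z - 1)])
  calc _ ≤ 5 / (s * (t * u)) * (p * (Ca * (T ^ (p - 1) / u ^ (p - 1 + 1)) * Real.exp E)
        + 6 * a * u ^ 4 * η * (Cb * (T ^ (p + 1) / u ^ (p + 1 + 1)) * Real.exp E)
        + 4 * b * u ^ 4 * (Cc * (T ^ (p + 3) / u ^ (p + 3 + 1)) * Real.exp E)) := by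
        refine hosc.trans ?_
        gcongr
    _ ≤ 5 / (s * (t * u)) * (Q * (T ^ (p + 3) / u ^ p * Real.exp E)) := by
        refine mul_le_mul_of_nonneg_left ?_ (by positivity)
        rw [hQ]
        linarith
    _ = 5 / s * (Q * L ^ (p + 3)) / (t * u ^ (p + 1)) * ((1 + z) ^ (p + 3) * Real.exp E) := by
        rw [hT, mul_pow, pow_succ u p]
        field_simp
    _ ≤ 5 / s * (Q * L ^ (p + 3)) / (t * u ^ (p + 1)) *
        (C' * Real.exp (δ / 4 * z ^ 2) * Real.exp (-(δ / 2) * z ^ 2)) := by gcongr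
    _ = 5 / s * (Q * L ^ (p + 3) * C') / (t * u ^ (p + 1)) *
        (Real.exp (δ / 4 * z ^ 2) * Real.exp (-(δ / 2) * z ^ 2)) := by ring
    _ = _ := by rw [← Real.exp_add]; ring_nf

/-! ### Common constants for the regimes -/

theorem le_mul_exp_of_le {B C₁ c₁ C c P W : ℝ} (hP : 0 ≤ P) (hW : 0 ≤ W) (hC₁ : 0 ≤ C₁)
    (hC : C₁ ≤ C) (hc : c ≤ c₁) (h : B ≤ C₁ * (P * Real.exp (-c₁ * W))) :
    B ≤ C * (P * Real.exp (-c * W)) := by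
  have hCC := hC₁.trans hC
  refine h.trans ?_
  gcongr

theorem le_div_mul_exp_of_le {B C₁ c₁ C c P W : ℝ} (hP : 0 ≤ P) (hW : 0 ≤ W)
    (hC₁ : 0 ≤ C₁) (hC : C₁ ≤ C) (hc : c ≤ c₁) (h : B ≤ C₁ / P * Real.exp (-c₁ * W)) :
    B ≤ C / P * Real.exp (-c * W) := by
  have := le_mul_exp_of_le (inv_nonneg.2 hP) hW hC₁ hC hc (B := B)
    (by rwa [← mul_assoc, ← div_eq_mul_inv])
  rwa [← mul_assoc, ← div_eq_mul_inv] at this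

theorem exists_regimeBound {a b : ℝ} (ha : 0 < a) (hb : 0 < b) (p : ℕ) {ymin : ℝ}
    (hymin : 0 < ymin) {k : ℝ} (hk : 0 < k) :
    ∃ C c : ℝ, 0 < C ∧ 0 < c ∧ ∀ x y : ℝ, ymin ≤ y →
      RegimeBound p k C c x y ‖lineIntegral a b p x y 0‖ := by
  obtain ⟨C₁, c₁, hC₁, hc₁, h₁⟩ := exists_lineIntegral_le_far a hb p hk
  obtain ⟨C₂, c₂, hC₂, hc₂, h₂⟩ := exists_lineIntegral_le_right ha hb p hymin hk
  obtain ⟨C₃, hC₃, h₃⟩ := exists_lineIntegral_le_transition ha hb p hymin one_pos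
  obtain ⟨C₄, c₄, hC₄, hc₄, h₄⟩ := exists_lineIntegral_le_left ha hb p hymin hk
  refine ⟨C₁ + C₂ + C₃ + C₄, min c₁ (min c₂ c₄), by positivity, by positivity,
    fun x y hy => ?_⟩
  have hy0 : 0 < y := hymin.trans_le hy
  have hy3 : 0 < y ^ (1 / 3 : ℝ) := by positivity
  have m₁ : min c₁ (min c₂ c₄) ≤ c₁ := min_le_left _ _
  have m₂ : min c₁ (min c₂ c₄) ≤ c₂ := (min_le_right _ _).trans (min_le_left _ _)
  have m₄ : min c₁ (min c₂ c₄) ≤ c₄ := (min_le_right _ _).trans (min_le_right _ _)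
  have hky : 0 < k * y := by positivity
  refine ⟨fun h => ?_, fun h h' => ?_, fun h h' => ?_, fun h h' => ?_, fun h => ?_⟩
  · have hx : 0 < x := hky.trans_le h
    have := h₁ x y hy0 (by rwa [abs_of_pos hx])
    rw [abs_of_pos hx] at this
    exact le_div_mul_exp_of_le (by positivity) (by positivity) hC₁.le (by linarith) m₁ this
  · exact le_div_mul_exp_of_le (by positivity) (by positivity) hC₂.le (by linarith) m₂
      (h₂ x y hy h h')
  · refine (h₃ x y hy (by rw [one_mul, abs_of_nonpos h']; linarith)).trans ?_
    gcongr
    linarith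
  · exact le_div_mul_exp_of_le (by positivity) (by positivity) hC₄.le (by linarith) m₄
      (h₄ x y hy (by linarith) h)
  · exact le_div_mul_exp_of_le (by positivity) (by positivity) hC₁.le (by linarith) m₁
      (h₁ x y hy0 (by rw [abs_of_neg (by linarith)]; linarith))

theorem RegimeBound.of_le {p : ℕ} {k C c x y B B' : ℝ} (h : RegimeBound p k C c x y B)
    (hB : B' ≤ B) : RegimeBound p k C c x y B' :=
  ⟨fun h1 => hB.trans (h.1 h1), fun h1 h2 => hB.trans (h.2.1 h1 h2),
    fun h1 h2 => hB.trans (h.2.2.1 h1 h2), fun h1 h2 => hB.trans (h.2.2.2.1 h1 h2),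
    fun h1 => hB.trans (h.2.2.2.2 h1)⟩

theorem norm_one_div_two_pi_mul_le (z : ℂ) : ‖1 / (2 * (Real.pi : ℂ)) * z‖ ≤ ‖z‖ := by
  rw [norm_mul]
  refine mul_le_of_le_one_left (norm_nonneg z) ?_
  have : ‖1 / (2 * (Real.pi : ℂ))‖ = 1 / (2 * Real.pi) := by
    simp [abs_of_pos Real.pi_pos]
  rw [this, div_le_one (by positivity)]
  linarith [Real.pi_gt_three]

theorem norm_lineIntegral_neg (a b : ℝ) (p : ℕ) (x y : ℝ) :
    ‖lineIntegral a b p x y 0‖ = ‖lineIntegral (-a) b p (-x) y 0‖ := by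
  rw [lineIntegral_neg, norm_mul, norm_pow, norm_neg, norm_one, one_pow, one_mul]

theorem c₄_pos {α : ℝ} (hα : |α| < 1) (hα0 : α ≠ 0) : 0 < c₄ α := by
  have h1 : α ^ 2 < 1 := (sq_lt_one_iff_abs_lt_one α).2 hα
  have h2 : 0 < 1 - α ^ 2 := by linarith
  unfold c₄
  positivity

/-! ### The activation function: differentiation in `y` -/

theorem activation_eq (α η x y : ℝ) :
    activation α η x y = 1 / (2 * (Real.pi : ℂ)) *
      ∫ θ : ℝ, quarticExp (c₃ α) (c₄ α) x y (η + θ * I) / (η + θ * I) := by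
  unfold activation quarticExp
  congr 1
  refine integral_congr_ae (Eventually.of_forall fun θ => ?_)
  simp only [← Complex.exp_add, mul_comm I (θ : ℂ)]
  congr 2
  ring

theorem line_ne_zero {η : ℝ} (hη : 0 < η) (θ : ℝ) : (η : ℂ) + θ * I ≠ 0 := fun h => by
  have := congrArg Complex.re h
  simp at this
  exact hη.ne' this

/-- The logarithm of the norm is affine in `y`, so the maximum over an interval is at an endpoint.
This gives the domination needed to differentiate under the integral. -/
theorem norm_quarticExp_le_add (a b x η θ : ℝ) {y y₁ y₂ : ℝ} (h₁ : y₁ ≤ y) (h₂ : y ≤ y₂) :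
    ‖quarticExp a b x y (η + θ * I)‖ ≤
      ‖quarticExp a b x y₁ (η + θ * I)‖ + ‖quarticExp a b x y₂ (η + θ * I)‖ := by
  have e : ∀ y : ℝ, ‖quarticExp a b x y (η + θ * I)‖ = Real.exp (x * η +
      y * (-a * (η ^ 3 - 3 * η * θ ^ 2) - b * (η ^ 4 - 6 * η ^ 2 * θ ^ 2 + θ ^ 4))) := fun y => by
    rw [norm_quarticExp_line]
    ring_nf
  rw [e, e, e]
  set r := -a * (η ^ 3 - 3 * η * θ ^ 2) - b * (η ^ 4 - 6 * η ^ 2 * θ ^ 2 + θ ^ 4)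
  rcases le_total 0 r with h | h
  · refine le_add_of_nonneg_of_le (Real.exp_pos _).le (Real.exp_le_exp.2 ?_)
    nlinarith
  · refine le_add_of_le_of_nonneg (Real.exp_le_exp.2 ?_) (Real.exp_pos _).le
    nlinarith

/-- The factor `-aτ³ - bτ⁴` brought down by the derivative cancels the pole at `0`; the integrand
becomes entire and the line can return to the imaginary axis. -/
theorem hasDerivAt_integral_quarticExp_div (a : ℝ) {b : ℝ} (hb : 0 < b) (x : ℝ) {η : ℝ}
    (hη : 0 < η) {y : ℝ} (hy : 0 < y) :
    HasDerivAt (fun y => ∫ θ : ℝ, quarticExp a b x y (η + θ * I) / (η + θ * I))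
      (-a * lineIntegral a b 2 x y 0 - b * lineIntegral a b 3 x y 0) y := by
  have hi := fun (p : ℕ) {y : ℝ} (hy : 0 < y) => integrable_pow_mul_quarticExp a hb p x hy η
  have hc := fun y => continuous_quarticExp a b x y
  have hmeas : ∀ y : ℝ, AEStronglyMeasurable
      (fun θ : ℝ => quarticExp a b x y (η + θ * I) / (η + θ * I)) volume := fun y =>
    Continuous.aestronglyMeasurable (by
      have := hc y
      exact Continuous.div (by fun_prop) (by fun_prop) (line_ne_zero hη))
  set F' : ℝ → ℝ → ℂ := fun y θ => -a * (((η : ℂ) + θ * I) ^ 2 * quarticExp a b x y (η + θ * I))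
    - b * (((η : ℂ) + θ * I) ^ 3 * quarticExp a b x y (η + θ * I)) with hF'
  have hF'i : Integrable (F' y) := ((hi 2 hy).const_mul _).sub ((hi 3 hy).const_mul _)
  set bd : ℝ → ℝ := fun θ =>
    (|a| * ‖((η : ℂ) + θ * I) ^ 2 * quarticExp a b x (y / 2) (η + θ * I)‖
      + |a| * ‖((η : ℂ) + θ * I) ^ 2 * quarticExp a b x (2 * y) (η + θ * I)‖)
    + (b * ‖((η : ℂ) + θ * I) ^ 3 * quarticExp a b x (y / 2) (η + θ * I)‖
      + b * ‖((η : ℂ) + θ * I) ^ 3 * quarticExp a b x (2 * y) (η + θ * I)‖) with hbd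
  have hy1 : 0 < y / 2 := by positivity
  have hy2 : 0 < 2 * y := by positivity
  have hbdi : Integrable bd :=
    (((hi 2 hy1).norm.const_mul _).add ((hi 2 hy2).norm.const_mul _)).add
      (((hi 3 hy1).norm.const_mul _).add ((hi 3 hy2).norm.const_mul _))
  have hFi : Integrable (fun θ : ℝ => quarticExp a b x y (η + θ * I) / (η + θ * I)) := by
    refine ((hi 0 hy).norm.const_mul (1 / η)).mono' (hmeas y) (Eventually.of_forall fun θ => ?_)
    have h1 : η ≤ ‖(η : ℂ) + θ * I‖ := by
      have := Complex.re_le_norm ((η : ℂ) + θ * I)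
      simpa using this
    rw [norm_div, pow_zero, one_mul, one_div_mul_eq_div]
    gcongr
  have key := (hasDerivAt_integral_of_dominated_loc_of_deriv_le (μ := volume)
    (F := fun y (θ : ℝ) => quarticExp a b x y (η + θ * I) / (η + θ * I)) (F' := F')
    (bound := bd) (x₀ := y) (s := Ioo (y / 2) (2 * y)) (Ioo_mem_nhds (by linarith) (by linarith))
    (Eventually.of_forall hmeas) hFi hF'i.aestronglyMeasurable
    (Eventually.of_forall fun θ z hz => ?_) hbdi (Eventually.of_forall fun θ z _ => ?_)).2
  · refine key.congr_deriv ?_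
    rw [lineIntegral_eq a hb 2 x hy 0 η, lineIntegral_eq a hb 3 x hy 0 η]
    simp only [hF']
    rw [integral_sub ((hi 2 hy).const_mul _) ((hi 3 hy).const_mul _), integral_const_mul,
      integral_const_mul]
    rfl
  · have hE := norm_quarticExp_le_add a b x η θ hz.1.le hz.2.le
    simp only [hF', hbd]
    refine (norm_sub_le _ _).trans ?_
    simp only [norm_mul, norm_neg, Complex.norm_real, Real.norm_eq_abs, abs_of_pos hb]
    have h2 := mul_le_mul_of_nonneg_left hE
      (by positivity : 0 ≤ |a| * ‖((η : ℂ) + θ * I) ^ 2‖)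
    have h3 := mul_le_mul_of_nonneg_left hE (by positivity : 0 ≤ b * ‖((η : ℂ) + θ * I) ^ 3‖)
    linarith
  · have hz : HasDerivAt (fun y : ℝ => (y : ℂ)) 1 z := (hasDerivAt_id z).ofReal_comp
    have h1 : HasDerivAt (fun y : ℝ => (x : ℂ) * (η + θ * I) - a * y * (η + θ * I) ^ 3
        - b * y * (η + θ * I) ^ 4) (-a * (η + θ * I) ^ 3 - b * (η + θ * I) ^ 4) z := by
      refine ((((hz.const_mul (a : ℂ)).mul_const _).const_sub _).sub
        ((hz.const_mul (b : ℂ)).mul_const _)).congr_deriv ?_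
      ring
    refine (h1.cexp.div_const ((η : ℂ) + θ * I)).congr_deriv ?_
    have := line_ne_zero hη θ
    simp only [hF', quarticExp]
    field_simp

theorem norm_activation_sub_le {α : ℝ} (hα : |α| < 1) (hα0 : α ≠ 0) {η : ℝ} (hη : 0 < η) (x : ℝ)
    {y₁ y₂ R : ℝ} (hy₁ : 0 < y₁) (hy₂ : 0 < y₂)
    (hR : ∀ y ∈ uIcc y₂ y₁, |c₃ α| * ‖lineIntegral (c₃ α) (c₄ α) 2 x y 0‖
      + c₄ α * ‖lineIntegral (c₃ α) (c₄ α) 3 x y 0‖ ≤ R) :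
    ‖activation α η x y₁ - activation α η x y₂‖ ≤ R * |y₁ - y₂| := by
  have hb := c₄_pos hα hα0
  rw [activation_eq, activation_eq, ← mul_sub]
  refine (norm_one_div_two_pi_mul_le _).trans ?_
  refine Convex.norm_image_sub_le_of_norm_hasDerivWithin_le (s := uIcc y₂ y₁)
    (f := fun y => ∫ θ : ℝ, quarticExp (c₃ α) (c₄ α) x y (η + θ * I) / (η + θ * I))
    (fun y hy => (hasDerivAt_integral_quarticExp_div (c₃ α) hb x hη
      ((lt_min hy₂ hy₁).trans_le hy.1)).hasDerivWithinAt) (fun y hy => ?_)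
    (convex_uIcc _ _) left_mem_uIcc right_mem_uIcc
  refine le_trans ((norm_sub_le _ _).trans (le_of_eq ?_)) (hR y hy)
  rw [norm_mul, norm_mul, norm_neg, Complex.norm_real, Complex.norm_real, Real.norm_eq_abs,
    Real.norm_eq_abs, abs_of_pos hb]

/-! ### Weighted bounds for the mean value inequality -/

theorem rpow_le_four_mul_rpow {N y e e' : ℝ} (hN : 1 ≤ N) (hy : N / 2 ≤ y) (he0 : 0 ≤ e)
    (he : e ≤ e') (he' : e' ≤ 2) : N ^ e ≤ 4 * y ^ e' := by
  have hy0 : 0 < y := by linarith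
  calc N ^ e ≤ N ^ e' := Real.rpow_le_rpow_of_exponent_le hN he
    _ ≤ (2 * y) ^ e' := Real.rpow_le_rpow (by linarith) (by linarith) (he0.trans he)
    _ = 2 ^ e' * y ^ e' := Real.mul_rpow (by norm_num) hy0.le
    _ ≤ 2 ^ (2 : ℝ) * y ^ e' := by
        gcongr
        norm_num
    _ = 4 * y ^ e' := by norm_num

/-- With `r² = X/N^{1/3}` and `p ≥ 2`, the prefactor `X N^{-5/6}` is `r² N^{-1/2}`, at most `(1 +
r³) N^{-1/3}`. Half of the exponential in `r³` absorbs `1 + r³`. -/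
theorem exists_abs_mul_lineIntegral_le_right {a b s : ℝ} (ha : 0 < a) (hb : 0 < b) (hs : 0 < s)
    {p : ℕ} (hp : 2 ≤ p) (hp' : p ≤ 3) :
    ∃ C c : ℝ, 0 < C ∧ 0 < c ∧ ∀ X y N : ℝ, 1 ≤ N → N / 2 ≤ y → y ≤ N / s → 0 ≤ X → X ≤ N →
      |X| * ‖lineIntegral a b p X y 0‖ ≤ C * (1 / N ^ (1 / 3 : ℝ)
        * Real.exp (-c * (|X| ^ (3 / 2 : ℝ) / N ^ (1 / 2 : ℝ)))) := by
  obtain ⟨C, c, hC, hc, h⟩ := exists_lineIntegral_le_right ha hb p (ymin := 1 / 2) (by norm_num)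
    (k := 2) (by norm_num)
  set d := c * s ^ (1 / 2 : ℝ) with hd
  have hd0 : 0 < d := by positivity
  clear_value d
  obtain ⟨C', hC', habs⟩ := exists_one_add_pow_le_exp 1 (c := d / 2) (by positivity)
  refine ⟨4 * C * C', d / 2, by positivity, by positivity, fun X y N hN hy hyN hX hXN => ?_⟩
  have hN0 : 0 < N := by linarith
  have hy0 : 0 < y := by linarith
  have hL := h X y (by linarith) hX (by linarith)
  have hp2 : (2 : ℝ) ≤ p := by exact_mod_cast hp
  have hp3 : (p : ℝ) ≤ 3 := by exact_mod_cast hp'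
  have hpow := rpow_le_four_mul_rpow (e := 5 / 6) (e' := 1 / 3 + (p : ℝ) / 4) hN hy (by norm_num)
    (by linarith) (by linarith)
  have hW : d * (X ^ (3 / 2 : ℝ) / N ^ (1 / 2 : ℝ)) ≤ c * (X ^ (3 / 2 : ℝ) / y ^ (1 / 2 : ℝ)) := by
    rw [hd, mul_assoc]
    refine mul_le_mul_of_nonneg_left ?_ hc.le
    calc s ^ (1 / 2 : ℝ) * (X ^ (3 / 2 : ℝ) / N ^ (1 / 2 : ℝ))
        = X ^ (3 / 2 : ℝ) / (N / s) ^ (1 / 2 : ℝ) := by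
          rw [Real.div_rpow hN0.le hs.le]
          field_simp
      _ ≤ _ := by gcongr
  rw [abs_of_nonneg hX]
  obtain ⟨v, hv, rfl⟩ := exists_pow_eq hN0 (n := 12) (by norm_num)
  have hv1 : 1 ≤ v := (one_le_pow_iff_of_nonneg hv.le (by norm_num)).1 hN
  obtain ⟨t, ht, rfl⟩ : ∃ t : ℝ, 0 ≤ t ∧ t ^ 2 = X := ⟨_, Real.sqrt_nonneg X, Real.sq_sqrt hX⟩
  rw [pow_rpow_eq ht 2 (3 / 2) 3 (by norm_num), pow_rpow_eq hv.le 12 (1 / 2) 6 (by norm_num)]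
    at hW ⊢
  rw [pow_rpow_eq hv.le 12 _ 4 (by norm_num)]
  rw [pow_rpow_eq hv.le 12 _ 10 (by norm_num)] at hpow
  rw [pow_rpow_eq ht 2 _ 3 (by norm_num)] at hL
  set r := t / v ^ 2 with hr
  have hr0 : 0 ≤ r := by positivity
  have hr3 : t ^ 3 / v ^ 6 = r ^ 3 := by rw [hr]; field_simp
  rw [hr3] at hW ⊢
  have hrr := habs (r ^ 3) (r ^ 3) (by positivity) (by linarith)
  rw [pow_one] at hrr
  have ht2 : t ^ 2 / v ^ 10 ≤ (1 + r ^ 3) / v ^ 4 := by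
    have e1 : t ^ 2 / v ^ 10 = (r ^ 2 / v ^ 2) / v ^ 4 := by rw [hr]; field_simp
    rw [e1]
    gcongr
    have e2 : r ^ 2 / v ^ 2 ≤ r ^ 2 := div_le_self (by positivity) (one_le_pow₀ hv1)
    have e3 : r ^ 2 ≤ 1 + r ^ 3 := by
      rcases le_total r 1 with h1 | h1
      · linarith [pow_nonneg hr0 3, pow_le_one₀ hr0 h1 (n := 2)]
      · linarith [pow_le_pow_right₀ h1 (show 2 ≤ 3 by norm_num)]
    exact e2.trans e3
  calc t ^ 2 * ‖lineIntegral a b p (t ^ 2) y 0‖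
      ≤ t ^ 2 * (C / y ^ ((1 : ℝ) / 3 + (p : ℝ) / 4)
        * Real.exp (-c * (t ^ 3 / y ^ (1 / 2 : ℝ)))) := by gcongr
    _ ≤ t ^ 2 * (C / (v ^ 10 / 4) * Real.exp (-(d * r ^ 3))) := by
        gcongr
        · linarith
        · linarith
    _ = 4 * C * (t ^ 2 / v ^ 10) * Real.exp (-(d * r ^ 3)) := by field_simp
    _ ≤ 4 * C * (C' * Real.exp (d / 2 * r ^ 3) / v ^ 4) * Real.exp (-(d * r ^ 3)) := by
        refine mul_le_mul_of_nonneg_right (mul_le_mul_of_nonneg_left (ht2.trans ?_) (by positivity))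
          (Real.exp_pos _).le
        exact div_le_div_of_nonneg_right (by linarith) (by positivity)
    _ = 4 * C * C' * (1 / v ^ 4 * (Real.exp (d / 2 * r ^ 3) * Real.exp (-(d * r ^ 3)))) := by ring
    _ = _ := by rw [← Real.exp_add]; ring_nf

theorem exists_abs_mul_lineIntegral_le_transition {a b : ℝ} (ha : 0 < a) (hb : 0 < b)
    {p : ℕ} (hp : 2 ≤ p) (hp' : p ≤ 3) :
    ∃ C : ℝ, 0 < C ∧ ∀ X y N : ℝ, 1 ≤ N → N / 2 ≤ y → |X| ≤ N ^ (1 / 3 : ℝ) →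
      |X| * ‖lineIntegral a b p X y 0‖ ≤ C * (1 / N ^ (1 / 3 : ℝ)) := by
  obtain ⟨C, hC, h⟩ := exists_lineIntegral_le_transition ha hb p (ymin := 1 / 2) (by norm_num)
    (M := 4) (by norm_num)
  refine ⟨4 * C, by positivity, fun X y N hN hy hX => ?_⟩
  have hN0 : 0 < N := by linarith
  have hy0 : 0 < y := by linarith
  have hp2 : (2 : ℝ) ≤ p := by exact_mod_cast hp
  have hp3 : (p : ℝ) ≤ 3 := by exact_mod_cast hp'
  have hL := h X y (by linarith) (hX.trans
    (rpow_le_four_mul_rpow hN hy (by norm_num) le_rfl (by norm_num)))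
  have hpow := rpow_le_four_mul_rpow (e := 5 / 6) (e' := 1 / 3 + (p : ℝ) / 4) hN hy (by norm_num)
    (by linarith) (by linarith)
  calc |X| * ‖lineIntegral a b p X y 0‖
      ≤ N ^ (1 / 3 : ℝ) * (C / y ^ ((1 : ℝ) / 3 + (p : ℝ) / 4)) := by gcongr
    _ ≤ N ^ (1 / 3 : ℝ) * (C / (N ^ (5 / 6 : ℝ) / 4)) := by
        gcongr
        linarith
    _ = 4 * C * (N ^ (1 / 3 : ℝ) / N ^ (5 / 6 : ℝ)) := by field_simp
    _ ≤ 4 * C * (1 / N ^ (1 / 3 : ℝ)) := by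
        refine mul_le_mul_of_nonneg_left ?_ (by positivity)
        -- The quotient is `N^{-1/2}`, which is at most `N^{-1/3}` because `N ≥ 1`.
        rw [div_le_div_iff₀ (by positivity) (by positivity), one_mul, ← Real.rpow_add hN0]
        exact Real.rpow_le_rpow_of_exponent_le hN (by norm_num)

/-- The factor `|X|` and the decay `N^{-3/4}` combine into `r N^{-1/4}` with `r = |X|/N^{1/2}`, and
half of the Gaussian in `r` absorbs `r`. -/
theorem exists_abs_mul_lineIntegral_le_left {a b s : ℝ} (ha : 0 < a) (hb : 0 < b) (hs : 0 < s)
    {p : ℕ} (hp : 2 ≤ p) (hp' : p ≤ 3) :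
    ∃ C c : ℝ, 0 < C ∧ 0 < c ∧ ∀ X y N : ℝ, 1 ≤ N → N / 2 ≤ y → y ≤ N / s → X < 0 → -N ≤ X →
      |X| * ‖lineIntegral a b p X y 0‖ ≤ C * (1 / (|X| ^ (1 / 4 : ℝ) * N ^ (1 / 4 : ℝ))
        * Real.exp (-c * (|X| ^ 2 / N))) := by
  obtain ⟨C, c, hC, hc, h⟩ := exists_lineIntegral_le_left ha hb p (ymin := 1 / 2) (by norm_num)
    (k := 2) (by norm_num)
  set d := c * s with hd
  have hd0 : 0 < d := by positivity
  clear_value d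
  obtain ⟨C', hC', habs⟩ := exists_one_add_pow_le_exp 1 (c := d / 2) (by positivity)
  refine ⟨4 * C * C', d / 2, by positivity, by positivity, fun X y N hN hy hyN hX hXN => ?_⟩
  have hN0 : 0 < N := by linarith
  have hy0 : 0 < y := by linarith
  have hL := h X y (by linarith) hX (by linarith)
  have hp2 : (2 : ℝ) ≤ p := by exact_mod_cast hp
  have hp3 : (p : ℝ) ≤ 3 := by exact_mod_cast hp'
  have hpow := rpow_le_four_mul_rpow (e := 3 / 4) (e' := ((p : ℝ) + 1) / 4) hN hy (by norm_num)
    (by linarith) (by linarith)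
  have hW : d * (X ^ 2 / N) ≤ c * (X ^ 2 / y) := by
    rw [hd, mul_assoc]
    refine mul_le_mul_of_nonneg_left ?_ hc.le
    calc s * (X ^ 2 / N) = X ^ 2 / (N / s) := by field_simp
      _ ≤ _ := by gcongr
  rw [← sq_abs X] at hW hL
  obtain ⟨v, hv, rfl⟩ := exists_pow_eq hN0 (n := 12) (by norm_num)
  obtain ⟨t, ht, htX⟩ := exists_pow_eq (abs_pos.2 hX.ne) (n := 4) (by norm_num)
  rw [← htX] at hL hW ⊢
  rw [pow_rpow_eq ht.le 4 _ 1 (by norm_num), pow_one] at hL ⊢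
  rw [pow_rpow_eq hv.le 12 _ 3 (by norm_num)]
  rw [pow_rpow_eq hv.le 12 _ 9 (by norm_num)] at hpow
  set r := t ^ 4 / v ^ 6 with hr
  have hr0 : 0 < r := by positivity
  have hr2 : (t ^ 4) ^ 2 / v ^ 12 = r ^ 2 := by rw [hr]; field_simp
  rw [hr2] at hW ⊢
  have hrr := habs r (r ^ 2) hr0.le (by linarith [sq_nonneg (r - 1)])
  rw [pow_one] at hrr
  calc t ^ 4 * ‖lineIntegral a b p X y 0‖
      ≤ t ^ 4 * (C / (t * y ^ (((p : ℝ) + 1) / 4)) * Real.exp (-c * ((t ^ 4) ^ 2 / y))) := by gcongr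
    _ ≤ t ^ 4 * (C / (t * (v ^ 9 / 4)) * Real.exp (-(d * r ^ 2))) := by
        gcongr
        · linarith
        · linarith
    _ = 4 * C * (1 / (t * v ^ 3)) * r * Real.exp (-(d * r ^ 2)) := by rw [hr]; field_simp
    _ ≤ 4 * C * (1 / (t * v ^ 3)) * (C' * Real.exp (d / 2 * r ^ 2)) * Real.exp (-(d * r ^ 2)) := by
        gcongr
        linarith
    _ = 4 * C * C' * (1 / (t * v ^ 3) * (Real.exp (d / 2 * r ^ 2) * Real.exp (-(d * r ^ 2)))) := by
        ring
    _ = _ := by rw [← Real.exp_add]; ring_nf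

/-- Three regimes for `|X| * (a ‖L₂‖ + b ‖L₃‖)`, at heights `y` comparable to `N`. -/
theorem exists_weighted_lineIntegral_le {a b s : ℝ} (ha : 0 < a) (hb : 0 < b) (hs : 0 < s) :
    ∃ C c : ℝ, 0 < C ∧ 0 < c ∧ ∀ X y N : ℝ, 1 ≤ N → N / 2 ≤ y → y ≤ N / s → |X| ≤ N →
      (0 ≤ X → |X| * (a * ‖lineIntegral a b 2 X y 0‖ + b * ‖lineIntegral a b 3 X y 0‖) ≤
        C * (1 / N ^ (1 / 3 : ℝ) * Real.exp (-c * (|X| ^ (3 / 2 : ℝ) / N ^ (1 / 2 : ℝ))))) ∧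
      (|X| ≤ N ^ (1 / 3 : ℝ) →
        |X| * (a * ‖lineIntegral a b 2 X y 0‖ + b * ‖lineIntegral a b 3 X y 0‖) ≤
          C * (1 / N ^ (1 / 3 : ℝ))) ∧
      (X < 0 → |X| * (a * ‖lineIntegral a b 2 X y 0‖ + b * ‖lineIntegral a b 3 X y 0‖) ≤
        C * (1 / (|X| ^ (1 / 4 : ℝ) * N ^ (1 / 4 : ℝ)) * Real.exp (-c * (|X| ^ 2 / N)))) := by
  obtain ⟨C₁, c₁, hC₁, hc₁, h₁⟩ :=
    exists_abs_mul_lineIntegral_le_right ha hb hs (p := 2) (by norm_num) (by norm_num)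
  obtain ⟨C₂, c₂, hC₂, hc₂, h₂⟩ :=
    exists_abs_mul_lineIntegral_le_right ha hb hs (p := 3) (by norm_num) (by norm_num)
  obtain ⟨C₃, hC₃, h₃⟩ :=
    exists_abs_mul_lineIntegral_le_transition ha hb (p := 2) (by norm_num) (by norm_num)
  obtain ⟨C₄, hC₄, h₄⟩ :=
    exists_abs_mul_lineIntegral_le_transition ha hb (p := 3) (by norm_num) (by norm_num)
  obtain ⟨C₅, c₅, hC₅, hc₅, h₅⟩ :=
    exists_abs_mul_lineIntegral_le_left ha hb hs (p := 2) (by norm_num) (by norm_num)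
  obtain ⟨C₆, c₆, hC₆, hc₆, h₆⟩ :=
    exists_abs_mul_lineIntegral_le_left ha hb hs (p := 3) (by norm_num) (by norm_num)
  set C := C₁ + C₂ + C₃ + C₄ + C₅ + C₆ with hC
  set c := min (min c₁ c₂) (min c₅ c₆) with hc
  have hC0 : 0 < C := by positivity
  have hc0 : 0 < c := by positivity
  have m₁ : c ≤ c₁ := (min_le_left _ _).trans (min_le_left _ _)
  have m₂ : c ≤ c₂ := (min_le_left _ _).trans (min_le_right _ _)
  have m₅ : c ≤ c₅ := (min_le_right _ _).trans (min_le_left _ _)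
  have m₆ : c ≤ c₆ := (min_le_right _ _).trans (min_le_right _ _)
  have combine : ∀ {r u v R : ℝ}, r * u ≤ C * R → r * v ≤ C * R →
      r * (a * u + b * v) ≤ (a + b) * C * R := fun {r u v R} hu hv => by
    have := mul_le_mul_of_nonneg_left hu ha.le
    have := mul_le_mul_of_nonneg_left hv hb.le
    linarith
  refine ⟨(a + b) * C, c, by positivity, hc0, fun X y N hN hy hyN hX => ?_⟩
  have hN0 : 0 < N := by linarith
  refine ⟨fun h => combine ?_ ?_, fun h => combine ?_ ?_, fun h => combine ?_ ?_⟩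
  · exact le_mul_exp_of_le (by positivity) (by positivity) hC₁.le (by linarith) m₁
      (h₁ X y N hN hy hyN h (le_of_abs_le hX))
  · exact le_mul_exp_of_le (by positivity) (by positivity) hC₂.le (by linarith) m₂
      (h₂ X y N hN hy hyN h (le_of_abs_le hX))
  · exact (h₃ X y N hN hy h).trans (mul_le_mul_of_nonneg_right (by linarith) (by positivity))
  · exact (h₄ X y N hN hy h).trans (mul_le_mul_of_nonneg_right (by linarith) (by positivity))
  · exact le_mul_exp_of_le (by positivity) (by positivity) hC₅.le (by linarith) m₅
      (h₅ X y N hN hy hyN h (neg_le_of_abs_le hX))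
  · exact le_mul_exp_of_le (by positivity) (by positivity) hC₆.le (by linarith) m₆
      (h₆ X y N hN hy hyN h (neg_le_of_abs_le hX))

/-- The heights `n` and `j/|α|` differ by `|j - n|α||/|α|`, and every height between them lies in
`[n/2, n/|α|]`. -/
theorem norm_activation_sub_le_of_neg {α : ℝ} (hα : |α| < 1) (hα0 : α ≠ 0) (hc₃ : c₃ α < 0)
    {η : ℝ} (hη : 0 < η) {n j R : ℝ} (hn : 1 ≤ n) (hj : n * |α| / 2 ≤ j) (hjn : j ≤ n)
    (hR : ∀ y : ℝ, n / 2 ≤ y → y ≤ n / |α| → |j - n * (|α|)| *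
      (-c₃ α * ‖lineIntegral (-c₃ α) (c₄ α) 2 (j - n * |α|) y 0‖
        + c₄ α * ‖lineIntegral (-c₃ α) (c₄ α) 3 (j - n * |α|) y 0‖) ≤ R) :
    ‖activation α η (-j + n * |α|) (j / |α|) - activation α η (-j + n * |α|) n‖ ≤ R / |α| := by
  have hα1 : 0 < |α| := abs_pos.2 hα0
  have hb := c₄_pos hα hα0
  have hn0 : 0 < n := by linarith
  have hj0 : 0 < j := lt_of_lt_of_le (by positivity) hj
  have hy : |j / |α| - n| = |j - n * (|α|)| / |α| := by
    rw [show j / |α| - n = (j - n * |α|) / |α| by field_simp, abs_div, abs_abs]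
  have hlow : n / 2 ≤ j / |α| := by
    rw [le_div_iff₀ hα1]
    linarith
  have hhigh : j / |α| ≤ n / |α| := by gcongr
  have hnα : n ≤ n / |α| := le_div_self hn0.le hα1 hα.le
  -- The Lipschitz constant used below is `R / |j - n|α||`. When the denominator vanishes the two
  -- heights coincide, and only `R ≥ 0` is needed.
  rcases eq_or_ne (j - n * |α|) 0 with h0 | h0
  · have hjα : j / |α| = n := by
      rw [div_eq_iff hα1.ne']
      linarith
    have hR0 := hR n (by linarith) hnα
    rw [h0, abs_zero, zero_mul] at hR0
    rw [hjα, sub_self, norm_zero]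
    positivity
  · have hX : 0 < |j - n * (|α|)| := abs_pos.2 h0
    have key := norm_activation_sub_le hα hα0 hη (-j + n * |α|) (R := R / |j - n * (|α|)|)
      (div_pos hj0 hα1) hn0 fun y hy => by
        have h := hR y ((le_min (by linarith) hlow).trans hy.1) (hy.2.trans (max_le hnα hhigh))
        rw [le_div_iff₀ hX, mul_comm, norm_lineIntegral_neg, norm_lineIntegral_neg _ _ 3,
          abs_of_neg hc₃, show -(-j + n * |α|) = j - n * |α| by ring]
        exact h
    refine key.trans (le_of_eq ?_)
    rw [hy]
    field_simp

end LaxWendroff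

/-! ### The main theorem -/

theorem mainTheorem9 (α : ℝ) (hα : |α| < 1) (hα0 : α ≠ 0) :
    -- the bounds on the correctors, `c₃` positive
    (0 < LaxWendroff.c₃ α →
      ∀ p : ℕ, 1 ≤ p → ∀ ymin : ℝ, 0 < ymin → ∀ k : ℝ, 0 < k →
        ∃ C c : ℝ, 0 < C ∧ 0 < c ∧ ∀ x y : ℝ, ymin ≤ y →
          LaxWendroff.RegimeBound p k C c x y ‖LaxWendroff.corrector α p x y‖) ∧
    -- the bounds on the correctors, `c₃` negative
    (LaxWendroff.c₃ α < 0 →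
      ∀ p : ℕ, 1 ≤ p → ∀ ymin : ℝ, 0 < ymin → ∀ k : ℝ, 0 < k →
        ∃ C c : ℝ, 0 < C ∧ 0 < c ∧ ∀ x y : ℝ, ymin ≤ y →
          LaxWendroff.RegimeBound p k C c (-x) y ‖LaxWendroff.corrector α p x y‖) ∧
    -- the difference of the two values of the activation function, `α` negative
    (α < 0 →
      ∃ C c : ℝ, 0 < C ∧ 0 < c ∧
        ∀ η : ℝ, 0 < η → ∀ n j₀ : ℕ, 1 ≤ n → 1 ≤ j₀ →
          (n : ℝ) * |α| / 2 ≤ (j₀ : ℝ) → j₀ ≤ n →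
          ((n : ℝ) * |α| ≤ (j₀ : ℝ) →
            ‖LaxWendroff.activation α η (-(j₀ : ℝ) + n * |α|) ((j₀ : ℝ) / |α|)
                - LaxWendroff.activation α η (-(j₀ : ℝ) + n * |α|) (n : ℝ)‖
              ≤ C * (1 / (n : ℝ) ^ (1 / 3 : ℝ)
                * Real.exp (-c * (|(j₀ : ℝ) - n * (|α|)| ^ (3 / 2 : ℝ)
                    / (n : ℝ) ^ (1 / 2 : ℝ))))) ∧
          (0 ≤ (n : ℝ) * |α| - j₀ → (n : ℝ) * |α| - j₀ ≤ (n : ℝ) ^ (1 / 3 : ℝ) →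
            ‖LaxWendroff.activation α η (-(j₀ : ℝ) + n * |α|) ((j₀ : ℝ) / |α|)
                - LaxWendroff.activation α η (-(j₀ : ℝ) + n * |α|) (n : ℝ)‖
              ≤ C * (1 / (n : ℝ) ^ (1 / 3 : ℝ))) ∧
          ((n : ℝ) ^ (1 / 3 : ℝ) ≤ (n : ℝ) * |α| - j₀ →
            ‖LaxWendroff.activation α η (-(j₀ : ℝ) + n * |α|) ((j₀ : ℝ) / |α|)
                - LaxWendroff.activation α η (-(j₀ : ℝ) + n * |α|) (n : ℝ)‖
              ≤ C * (1 / (|(j₀ : ℝ) - n * (|α|)| ^ (1 / 4 : ℝ) * (n : ℝ) ^ (1 / 4 : ℝ))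
                * Real.exp (-c * (|(j₀ : ℝ) - n * (|α|)| ^ 2 / (n : ℝ)))))) := by
  have hb := LaxWendroff.c₄_pos hα hα0
  refine ⟨fun hc₃ p _ ymin hymin k hk => ?_, fun hc₃ p _ ymin hymin k hk => ?_, fun hneg => ?_⟩
  · obtain ⟨C, c, hC, hc, h⟩ := LaxWendroff.exists_regimeBound hc₃ hb p hymin hk
    refine ⟨C, c, hC, hc, fun x y hy => (h x y hy).of_le ?_⟩
    rw [LaxWendroff.corrector_eq_lineIntegral]
    exact LaxWendroff.norm_one_div_two_pi_mul_le _
  · obtain ⟨C, c, hC, hc, h⟩ := LaxWendroff.exists_regimeBound (neg_pos.2 hc₃) hb p hymin hk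
    refine ⟨C, c, hC, hc, fun x y hy => (h (-x) y hy).of_le ?_⟩
    rw [LaxWendroff.corrector_eq_lineIntegral, ← LaxWendroff.norm_lineIntegral_neg]
    exact LaxWendroff.norm_one_div_two_pi_mul_le _
  · have hc₃ : LaxWendroff.c₃ α < 0 := by
      have h1 : α ^ 2 < 1 := (sq_lt_one_iff_abs_lt_one α).2 hα
      have h2 : α * (1 - α ^ 2) < 0 := mul_neg_of_neg_of_pos hneg (by linarith)
      unfold LaxWendroff.c₃
      linarith
    have hα1 : 0 < |α| := abs_pos.2 hα0
    obtain ⟨C, c, hC, hc, h⟩ :=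
      LaxWendroff.exists_weighted_lineIntegral_le (neg_pos.2 hc₃) hb hα1
    refine ⟨C / |α|, c, by positivity, hc, fun η hη n j₀ hn hj₀ hj hjn => ?_⟩
    have hn1 : (1 : ℝ) ≤ n := by exact_mod_cast hn
    have hjn' : (j₀ : ℝ) ≤ n := by exact_mod_cast hjn
    have hX : |(j₀ : ℝ) - n * (|α|)| ≤ n := by
      have : (n : ℝ) * |α| ≤ n := mul_le_of_le_one_right (by linarith) hα.le
      have : 0 ≤ (n : ℝ) * |α| := by positivity
      have : (0 : ℝ) ≤ j₀ := Nat.cast_nonneg _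
      rw [abs_le]
      constructor <;> linarith
    have main := fun R => LaxWendroff.norm_activation_sub_le_of_neg hα hα0 hc₃ hη hn1 hj hjn'
      (R := R)
    have hn3 : 0 < (n : ℝ) ^ (1 / 3 : ℝ) := by positivity
    refine ⟨fun h1 => ?_, fun h1 h2 => ?_, fun h1 => ?_⟩
    · rw [div_mul_eq_mul_div]
      exact main _ fun y hy hy' => (h _ y n hn1 hy hy' hX).1 (by linarith)
    · rw [div_mul_eq_mul_div]
      exact main _ fun y hy hy' => (h _ y n hn1 hy hy' hX).2.1 (by
        rw [abs_of_nonpos (by linarith)]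
        linarith)
    · rw [div_mul_eq_mul_div]
      exact main _ fun y hy hy' => (h _ y n hn1 hy hy' hX).2.2 (by linarith)
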